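/- **Setting.** There are $N$ devices, a finite dataset $\mathcal D_n(t)$ of data points at device $n$ at each wall-clock time $t$ (in seconds), a loss $f(\mathbf w,d)$, differentiable in $\mathbf w\in\mathbb R^M$, and a feature vector $\boldsymbol d$ for each data point $d$. For datasets $\mathcal D=(\mathcal D_n)_n$ put $F_n(\mathbf w|\mathcal D_n)=\frac1{|\mathcal D_n|}\sum_{d\in\mathcal D_n}f(\mathbf w,d)$, $|\mathcal D|=\sum_n|\mathcal D_n|$ and $F(\mathbf w|\mathcal D)=\sum_n\frac{|\mathcal D_n|}{|\mathcal D|}F_n(\mathbf w|\mathcal D_n)$. Training round $k=0,1,\dots$ is preceded by an idle period of $\Omega^{(k+1)}\in\mathbb Z_{\ge0}$ seconds. The first idle period starts at time $0$. At the beginning of round $k$ data points are moved between devices (none is created or lost), which gives nonempty datasets $\widehat{\mathcal D}^{(k)}_n$. Data arrive and depart only in idle periods, so the devices still hold the $\widehat{\mathcal D}^{(k)}_n$ when round $k$ ends. Let $\widehat D_n^{(k)}=|\widehat{\mathcal D}_n^{(k)}|$, $D^{(k)}=\sum_n\widehat D_n^{(k)}$, $F^{(k)}_n=F_n(\cdot|\widehat{\mathcal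 D}_n^{(k)})$, $F^{(k)}=F(\cdot|\widehat{\mathcal D}^{(k)})$, and let $F^{(-1)}=F(\cdot|\mathcal D(0))$ be the initial loss, at the start of the first idle period. Each $\widehat{\mathcal D}^{(k)}_n$ is partitioned into strata $\mathcal S^{(k)}_{n,j}$, $1\le j\le S^{(k)}_n$, of sizes $S^{(k)}_{n,j}$. **Algorithm (PSL).** From a deterministic $\mathbf w^{(0)}$, device $n$ in round $k$ sets $\mathbf w^{(k),0}_n=\mathbf w^{(k)}$ and, for $e=1,\dots,e^{(k)}_n$ ($e_n^{(k)}\ge1$), $$\mathbf w_n^{(k),e}=\mathbf w_n^{(k),e-1}-\frac{\eta_k}{\widehat D^{(k)}_n}\sum_{j=1}^{S^{(k)}_n}\sum_{d\in\mathcal B^{(k),e}_{n,j}}\frac{S^{(k)}_{n,j}\nabla f(\mathbf w_n^{(k),e-1},d)}{B^{(k)}_{n,j}},$$ where the mini-batches $\mathcal B^{(k),e}_{n,j}\subseteq\mathcal S^{(k)}_{n,j}$ are independent and uniform among the subsets of size $B^{(k)}_{n,j}$, $1\le B^{(k)}_{n,j}\le S^{(k)}_{n,j}$. Here $\eta_k>0$.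 Then $$\mathbf w^{(k+1)}=\mathbf w^{(k)}-\eta_k\sum_{n'}\frac{\widehat D^{(k)}_{n'}e^{(k)}_{n'}}{D^{(k)}}\sum_n\frac{\widehat D^{(k)}_n}{D^{(k)}e^{(k)}_n}\cdot\frac{\mathbf w^{(k)}-\mathbf w_n^{(k),e_n^{(k)}}}{\eta_k}.$$ **Assumptions.** Let $\beta>0$, $\zeta_1\ge1$, $\zeta_2\ge0$, $\Theta_n\ge0$, $\Theta=\max_n\Theta_n$. (i) $\|\nabla F_n^{(k)}(\mathbf w)-\nabla F_n^{(k)}(\mathbf w')\|\le\beta\|\mathbf w-\mathbf w'\|$ for all $n,k,\mathbf w,\mathbf w'$. (ii) $\sum_na_n\|\nabla F_n^{(k)}(\mathbf w)\|^2\le\zeta_1\|\sum_na_n\nabla F_n^{(k)}(\mathbf w)\|^2+\zeta_2$ for all $k,\mathbf w$ and all $a_n\ge0$ with $\sum_na_n=1$. (iii) $\|\nabla f(\mathbf w,d)-\nabla f(\mathbf w,d')\|\le\Theta_n\|\boldsymbol d-\boldsymbol d'\|$ for all $n,k,\mathbf w$ and $d,d'\in\widehat{\mathcal D}^{(k)}_n$.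 (iv) For every $t$ such that $[t-1,t]$ is one of the successive one-second intervals of an idle period, all $n$ and all $\mathbf w$: $\frac{|\mathcal D_n(t)|}{|\mathcal D(t)|}F_n(\mathbf w|\mathcal D_n(t))-\frac{|\mathcal D_n(t-1)|}{|\mathcal D(t-1)|}F_n(\mathbf w|\mathcal D_n(t-1))\le\Delta_n(t)$. Let $\Delta^{(k+1)}=\sum_n\max_t\Delta_n(t)$, the maximum over the times $t$ in (iv) that lie in the idle period before round $k$ (if $\Omega^{(k+1)}=0$ the value is irrelevant). Let $e^{(k)}_{\max}=\max_ne_n^{(k)}$ and $\Gamma^{(k)}=\frac{\eta_k}2\sum_n\frac{\widehat D^{(k)}_ne^{(k)}_n}{D^{(k)}}$. For $k<K$ let $0\le\Lambda^{(k)}<1$ and assume $$\eta_k\le\min\left\{\frac1{2\beta}\sqrt{\frac{\Lambda^{(k)}}{c^{(k)}\,e^{(k)}_{\max}(e^{(k)}_{\max}-1)}},\ \Big(2\beta\sum_n\frac{\widehat D_n^{(k)}e_n^{(k)}}{D^{(k)}}\Big)^{-1}\right\},\qquad c^{(k)}=\min\{\zeta_1(\beta^2+\Lambda^{(k)}),\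 \zeta_1+\Lambda^{(k)}\},$$ where the first bound is void if $e^{(k)}_{\max}=1$. **Theorem (General Convergence Behavior of PSL).** With $$V_n^{(k)}=\sum_{j=1}^{S_n^{(k)}}\Big(1-\frac{B^{(k)}_{n,j}}{S^{(k)}_{n,j}}\Big)\frac{S^{(k)}_{n,j}}{(\widehat D_n^{(k)})^2}\cdot\frac{(S^{(k)}_{n,j}-1)(\widetilde\sigma^{(k)}_{n,j})^2}{B^{(k)}_{n,j}},$$ where $(\widetilde\sigma^{(k)}_{n,j})^2$ is the sample variance (total, with divisor $S_{n,j}^{(k)}-1$) of the feature vectors in $\mathcal S^{(k)}_{n,j}$, and terms with $S^{(k)}_{n,j}=1$ are $0$, one has for every $K\ge1$ $$\frac1K\sum_{k=0}^{K-1}\mathbb E\|\nabla F^{(k)}(\mathbf w^{(k)})\|^2\le\frac1K\Bigg[\sum_{k=0}^{K-1}\frac{\mathbb E[F^{(k-1)}(\mathbf w^{(k)})-F^{(k)}(\mathbf w^{(k+1)})]}{\Gamma^{(k)}(1-\Lambda^{(k)})}+\sum_{k=0}^{K-1}\frac{\Omega^{(k+1)}\Delta^{(k+1)}}{\Gamma^{(k)}(1-\Lambda^{(k)})}$$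 $$+\sum_{k=0}^{K-1}\frac1{1-\Lambda^{(k)}}\Bigg(8\beta^2\Theta^2\eta_k^2\sum_n\frac{\widehat D_n^{(k)}}{D^{(k)}}(e_n^{(k)}-1)V_n^{(k)}+8\zeta_2\eta_k^2\beta^2e^{(k)}_{\max}(e^{(k)}_{\max}-1)+8\Theta^2\beta\Gamma^{(k)}\sum_n\Big(\frac{\widehat D_n^{(k)}}{D^{(k)}\sqrt{e_n^{(k)}}}\Big)^2V_n^{(k)}\Bigg)\Bigg].$$ -/

import Mathlib

open MeasureTheory ProbabilityTheory

noncomputable section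

/-- The average loss of the model `w` over a dataset `D` (`f w d` is the loss at the point `d`). -/
def localLoss {M : ℕ} {X : Type*} (f : EuclideanSpace ℝ (Fin M) → X → ℝ) (D : Finset X)
    (w : EuclideanSpace ℝ (Fin M)) : ℝ :=
  (∑ d ∈ D, f w d) / (D.card : ℝ)

/-- Total number of data points of a family of device datasets. -/
def totalCard {N : ℕ} {X : Type*} (D : Fin N → Finset X) : ℝ :=
  ∑ n, ((D n).card : ℝ)

/-- The global loss: the average of the local losses, weighted by the dataset sizes. -/
def globalLoss {N M : ℕ} {X : Type*} (f : EuclideanSpace ℝ (Fin M) → X → ℝ)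
    (D : Fin N → Finset X) (w : EuclideanSpace ℝ (Fin M)) : ℝ :=
  (1 / totalCard D) * ∑ n, ((D n).card : ℝ) * localLoss f (D n) w

/-- Wall-clock time (in seconds) at which the idle period that precedes training round `k` begins.
The idle period before round `k` lasts `Ω (k + 1)` seconds, and round `k` itself (which turns the
model `w k` into `w (k + 1)`) takes `T k` seconds. -/
def idleStart (Ω : ℕ → ℕ) (T : ℕ → ℝ) : ℕ → ℝ
  | 0 => 0
  | k + 1 => idleStart Ω T k + (Ω (k + 1) : ℝ) + T k

/-- Wall-clock time at which training round `k` begins. -/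
def roundStart (Ω : ℕ → ℕ) (T : ℕ → ℝ) (k : ℕ) : ℝ :=
  idleStart Ω T k + (Ω (k + 1) : ℝ)

/-- A run of parallel successive learning, up to the random choice of the mini-batches:
`N` devices, models in `ℝ^M`, and data points in `X` with feature vectors in `ℝ^p`. -/
structure PSL (N M p : ℕ) (X : Type*) [DecidableEq X] where
  /-- feature vector of a data point -/
  feat : X → EuclideanSpace ℝ (Fin p)
  /-- loss of a model at a data point -/
  f : EuclideanSpace ℝ (Fin M) → X → ℝ
  /-- initial global model -/
  w₀ : EuclideanSpace ℝ (Fin M)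
  /-- idle times, in whole seconds -/
  Ω : ℕ → ℕ
  /-- device acquisition time of each round -/
  T : ℕ → ℝ
  T_pos : ∀ k, 0 < T k
  /-- dataset of each device at each wall-clock time -/
  data : ℝ → Fin N → Finset X
  /-- datasets used in round `k`, after the data dispersion among the devices -/
  Dhat : ℕ → Fin N → Finset X
  Dhat_nonempty : ∀ k n, (Dhat k n).Nonempty
  /-- dispersion moves data between devices; it neither creates nor deletes data points -/
  dispersion : ∀ k, ∑ n, (Dhat k n).val = ∑ n, (data (roundStart Ω T k) n).val
  /-- data arrive and depart only in idle periods: when a round ends, the devices still hold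
  the datasets that the round was run on -/
  data_end : ∀ k n, data (idleStart Ω T (k + 1)) n = Dhat k n
  /-- partition of the dataset of each device into strata -/
  strata : ∀ k n, Finpartition (Dhat k n)
  /-- number of points sampled from a stratum in each local iteration -/
  B : ℕ → Fin N → Finset X → ℕ
  B_pos : ∀ k n, ∀ S ∈ (strata k n).parts, 1 ≤ B k n S
  B_le : ∀ k n, ∀ S ∈ (strata k n).parts, B k n S ≤ S.card
  /-- number of local SGD iterations -/
  e : ℕ → Fin N → ℕ
  e_pos : ∀ k n, 1 ≤ e k n
  /-- step sizes -/
  η : ℕ → ℝ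
  η_pos : ∀ k, 0 < η k

/-- The possible mini-batches of size `b` from the stratum `S` (sampling without replacement). -/
def Batch {X : Type*} (S : Finset X) (b : ℕ) : Type _ := {A : Finset X // A ∈ S.powersetCard b}

instance {X : Type*} (S : Finset X) (b : ℕ) : MeasurableSpace (Batch S b) := ⊤

namespace PSL

variable {N M p : ℕ} {X : Type*} [DecidableEq X] (P : PSL N M p X)

/-- Local loss of device `n` in round `k`. -/
def localF (k : ℕ) (n : Fin N) : EuclideanSpace ℝ (Fin M) → ℝ := localLoss P.f (P.Dhat k n)

/-- Global loss of round `k`. -/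
def F (k : ℕ) : EuclideanSpace ℝ (Fin M) → ℝ := globalLoss P.f (P.Dhat k)

/-- The global loss with superscript `k - 1`: for `k = 0` it is the initial loss, at the
beginning of the first idle period. -/
def prevF : ℕ → EuclideanSpace ℝ (Fin M) → ℝ
  | 0 => globalLoss P.f (P.data (idleStart P.Ω P.T 0))
  | k + 1 => P.F k

/-- Number of data points of device `n` in round `k`. -/
def Dn (k : ℕ) (n : Fin N) : ℝ := ((P.Dhat k n).card : ℝ)

/-- Total number of data points in round `k`. -/
def D (k : ℕ) : ℝ := totalCard (P.Dhat k)

/-- Data-weighted average of the numbers of local iterations in round `k`. -/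
def eAvg (k : ℕ) : ℝ := ∑ n, P.Dn k n * (P.e k n : ℝ) / P.D k

/-- Largest number of local iterations in round `k`. -/
def eMax (k : ℕ) : ℕ := Finset.univ.sup (P.e k)

/-- `Γ`: half the step size times the average number of local iterations. -/
def Gam (k : ℕ) : ℝ := P.η k / 2 * P.eAvg k

/-- One realization of all mini-batches: round, device, local iteration, stratum. -/
abbrev Batches : Type _ :=
  ∀ (k : ℕ) (n : Fin N) (_ : ℕ) (S : (P.strata k n).parts), Batch S.1 (P.B k n S.1)

/-- Local SGD of device `n` in round `k`, started at `w`: the model after `i` iterations. -/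
def localModel (b : P.Batches) (k : ℕ) (n : Fin N) (w : EuclideanSpace ℝ (Fin M)) :
    ℕ → EuclideanSpace ℝ (Fin M)
  | 0 => w
  | i + 1 =>
    localModel b k n w i - (P.η k / P.Dn k n) •
      ∑ S : (P.strata k n).parts, ∑ d ∈ (b k n i S).1,
        ((S.1.card : ℝ) / (P.B k n S.1 : ℝ)) •
          gradient (fun v => P.f v d) (localModel b k n w i)

/-- Accumulated gradient of device `n` in round `k`, started at `w`. -/
def accGrad (b : P.Batches) (k : ℕ) (n : Fin N) (w : EuclideanSpace ℝ (Fin M)) :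
    EuclideanSpace ℝ (Fin M) :=
  (1 / P.η k) • (w - P.localModel b k n w (P.e k n))

/-- Normalized accumulated gradient of all devices in round `k`, started at `w`. -/
def aggGrad (b : P.Batches) (k : ℕ) (w : EuclideanSpace ℝ (Fin M)) :
    EuclideanSpace ℝ (Fin M) :=
  P.eAvg k • ∑ n, (P.Dn k n / (P.D k * (P.e k n : ℝ))) • P.accGrad b k n w

/-- The sequence of global models. -/
def model (b : P.Batches) : ℕ → EuclideanSpace ℝ (Fin M)
  | 0 => P.w₀
  | k + 1 => model b k - P.η k • P.aggGrad b k (model b k)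

/-- Index set of the mini-batches. -/
abbrev BatchIdx : Type _ := Σ (k : ℕ) (n : Fin N), ℕ × (P.strata k n).parts

/-- Stratified sampling: every mini-batch is uniform among the subsets of its stratum of the
prescribed size, and all mini-batches are independent. -/
structure StratifiedSampling {𝓢 : Type*} [MeasurableSpace 𝓢] (μ : Measure 𝓢)
    (b : 𝓢 → P.Batches) : Prop where
  measurable : ∀ k n i S, Measurable (fun s => b s k n i S)
  uniform : ∀ k n i S (A : Batch S.1 (P.B k n S.1)),
    μ.real {s | b s k n i S = A} = 1 / (Nat.choose S.1.card (P.B k n S.1) : ℝ)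
  indep : iIndepFun (fun (j : P.BatchIdx) (s : 𝓢) => b s j.1 j.2.1 j.2.2.1 j.2.2.2) μ

/-- Mean feature vector of a stratum. -/
def stratumMean (S : Finset X) : EuclideanSpace ℝ (Fin p) :=
  (1 / (S.card : ℝ)) • ∑ d ∈ S, P.feat d

/-- Sample standard deviation of the feature vectors in a stratum. -/
def stratumStd (S : Finset X) : ℝ :=
  Real.sqrt ((1 / ((S.card : ℝ) - 1)) * ∑ d ∈ S, ‖P.feat d - P.stratumMean S‖ ^ 2)

/-- The stratified sampling noise of device `n` in round `k`. -/
def noise (k : ℕ) (n : Fin N) : ℝ :=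
  ∑ S ∈ (P.strata k n).parts,
    (1 - (P.B k n S : ℝ) / (S.card : ℝ)) * ((S.card : ℝ) / (P.Dn k n) ^ 2) *
      (((S.card : ℝ) - 1) * (P.stratumStd S) ^ 2 / (P.B k n S : ℝ))

/-- `β`-smoothness of all local losses. -/
def Smooth (β : ℝ) : Prop :=
  ∀ k n w w', ‖gradient (P.localF k n) w - gradient (P.localF k n) w'‖ ≤ β * ‖w - w'‖

/-- Bounded dissimilarity of the local losses. -/
def BoundedDissimilarity (ζ₁ ζ₂ : ℝ) : Prop :=
  ∀ a : Fin N → ℝ, (∀ n, 0 ≤ a n) → ∑ n, a n = 1 → ∀ k w,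
    ∑ n, a n * ‖gradient (P.localF k n) w‖ ^ 2 ≤
      ζ₁ * ‖∑ n, a n • gradient (P.localF k n) w‖ ^ 2 + ζ₂

/-- The local data variability of device `n` is at most `Θ n`. -/
def DataVariability (Θ : Fin N → ℝ) : Prop :=
  ∀ k n w, ∀ d ∈ P.Dhat k n, ∀ d' ∈ P.Dhat k n,
    ‖gradient (fun v => P.f v d) w - gradient (fun v => P.f v d') w‖ ≤
      Θ n * ‖P.feat d - P.feat d'‖

/-- The contribution of device `n` to the global loss at wall-clock time `t`. -/
def wallLoss (n : Fin N) (t : ℝ) (w : EuclideanSpace ℝ (Fin M)) : ℝ :=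
  ((P.data t n).card : ℝ) / totalCard (P.data t) * localLoss P.f (P.data t n) w

/-- `Δ n t` bounds the drift of device `n` from time `t - 1` to time `t`, for `t` the end of any
one-second interval of an idle period. -/
def Drift (Δ : Fin N → ℝ → ℝ) : Prop :=
  ∀ k n (s : Fin (P.Ω (k + 1))) (t : ℝ), t = idleStart P.Ω P.T k + ((s : ℕ) : ℝ) + 1 →
    ∀ w, P.wallLoss n t w - P.wallLoss n (t - 1) w ≤ Δ n t

/-- Total drift of the idle period before round `k`: the sum over the devices of the largest
drift in that period (this is the quantity with superscript `k + 1`; an empty maximum is `0`). -/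
def maxDrift (Δ : Fin N → ℝ → ℝ) (k : ℕ) : ℝ :=
  ∑ n, ⨆ s : Fin (P.Ω (k + 1)), Δ n (idleStart P.Ω P.T k + ((s : ℕ) : ℝ) + 1)

end PSL

end

/-! Fix a round and a deterministic starting model. Let A be the gradient of the global loss there,
h = η · `eAvg`, and Z the weighted average of the stochastic gradients used, so that the round moves
the model by -hZ. The quadratic upper bound for a β-smooth loss reduces the expected descent to one
estimate: ‖A‖² - 2E⟨A, Z⟩ + βh E‖Z‖² is at most the error terms (`round_energy`); multiplying by h/2
= Γ gives the round's contribution.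

The estimate is Hilbert space geometry in L². Write Z = G + Ξ, with G the true gradients at the
local iterates and Ξ the sampling noise. Noise vectors of different local iterations are orthogonal
to each other and to the constants, but G is not orthogonal to Ξ, because local iterates remember
earlier noise. So G is split into its mean c and its fluctuation r. Then ‖A - G‖² = ‖A - c‖² + ‖r‖²
is small since local iterates stay near their start (`local_drift`), and only ‖r + Ξ‖² is treated
crudely; βh ≤ 1/2 absorbs that loss.

The noise is bounded by the second moment of sampling without replacement (`sum_sampleError_sq_le`).
Independence enters through `integral_dependsOn_eq_integral_integral`, a Fubini statement for
functions of finitely many mini-batches; it gives the orthogonality and also the passage from a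
deterministic to a random starting model. The change of the loss during an idle period is telescoped
in `F_sub_prevF_le`. The one-round estimate carries no factor 1 - Λ: Λ matters only in the step
size, and the final division by 1 - Λ is a weakening. -/

/-! ### Hilbert space estimates for one round of noisy local descent. -/

section Hilbert

set_option linter.unusedSectionVars false

variable {H : Type*} [NormedAddCommGroup H] [InnerProductSpace ℝ H]

lemma norm_add_sq_le_weighted (a b : H) {τ : ℝ} (hτ : 0 < τ) :
    ‖a + b‖ ^ 2 ≤ (1 + τ) * ‖a‖ ^ 2 + (1 + 1 / τ) * ‖b‖ ^ 2 := by
  have h1 : ‖a + b‖ ^ 2 ≤ (‖a‖ + ‖b‖) ^ 2 := by gcongr; exact norm_add_le a b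
  have h2 : 0 ≤ (τ * ‖a‖ - ‖b‖) ^ 2 / τ := by positivity
  have h3 : (τ * ‖a‖ - ‖b‖) ^ 2 / τ = τ * ‖a‖ ^ 2 - 2 * ‖a‖ * ‖b‖ + 1 / τ * ‖b‖ ^ 2 := by
    field_simp; ring
  nlinarith

lemma norm_sum_sq_le_card_mul {ι : Type*} (s : Finset ι) (f : ι → H) :
    ‖∑ i ∈ s, f i‖ ^ 2 ≤ (s.card : ℝ) * ∑ i ∈ s, ‖f i‖ ^ 2 :=
  (pow_le_pow_left₀ (norm_nonneg _) (norm_sum_le _ _) 2).trans sq_sum_le_card_mul_sum_sq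

lemma norm_sum_sq_of_pairwise_orthogonal {ι : Type*} (s : Finset ι) (f : ι → H)
    (h : ∀ i ∈ s, ∀ j ∈ s, i ≠ j → inner ℝ (f i) (f j) = 0) :
    ‖∑ i ∈ s, f i‖ ^ 2 = ∑ i ∈ s, ‖f i‖ ^ 2 := by
  classical
  rw [← real_inner_self_eq_norm_sq, sum_inner]
  refine Finset.sum_congr rfl fun i hi => ?_
  rw [inner_sum, Finset.sum_eq_single i, real_inner_self_eq_norm_sq]
  · exact fun j hj hji => h i hi j hj hji.symm
  · exact fun h' => absurd hi h'

lemma norm_weighted_sum_sq_le {ι : Type*} (s : Finset ι) (p : ι → ℝ) (hp : ∀ i ∈ s, 0 ≤ p i)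
    (hp1 : ∑ i ∈ s, p i = 1) (f : ι → H) :
    ‖∑ i ∈ s, p i • f i‖ ^ 2 ≤ ∑ i ∈ s, p i * ‖f i‖ ^ 2 := by
  have hc : ConvexOn ℝ Set.univ fun x : H => ‖x‖ ^ 2 :=
    (convexOn_norm convex_univ).pow (fun _ _ => norm_nonneg _) 2
  simpa using hc.map_sum_le hp hp1 (fun i _ => Set.mem_univ (f i))

lemma sum_range_cast_le (i : ℕ) : ∑ l ∈ Finset.range i, (l : ℝ) ≤ (i : ℝ) ^ 2 / 2 := by
  induction i with
  | zero => simp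
  | succ i ih => rw [Finset.sum_range_succ]; push_cast; nlinarith

lemma sum_range_cast_sq_le (i : ℕ) : ∑ l ∈ Finset.range i, (l : ℝ) ^ 2 ≤ (i : ℝ) ^ 3 / 3 := by
  induction i with
  | zero => simp
  | succ i ih =>
    rw [Finset.sum_range_succ]; push_cast
    nlinarith [(Nat.cast_nonneg i : (0 : ℝ) ≤ i)]

lemma sum_range_cast_eq (m : ℕ) :
    ∑ l ∈ Finset.range m, (l : ℝ) = (m : ℝ) * ((m : ℝ) - 1) / 2 := by
  induction m with
  | zero => simp
  | succ i ih => rw [Finset.sum_range_succ, ih]; push_cast; ring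

/-- Unlike m³/3, this bound keeps a factor m - 1, so the drift error vanishes for a single local
iteration. -/
lemma sum_range_cast_sq_le' (m : ℕ) :
    ∑ l ∈ Finset.range m, (l : ℝ) ^ 2 ≤ (m : ℝ) * ((m : ℝ) * ((m : ℝ) - 1)) / 3 := by
  induction m with
  | zero => simp
  | succ i ih =>
    rw [Finset.sum_range_succ]; push_cast
    nlinarith [(Nat.cast_nonneg i : (0 : ℝ) ≤ i)]

/-- Drift of noisy gradient descent from its starting point. -/
lemma local_drift {η β v : ℝ} {m : ℕ} (W U ξ : ℕ → H) (g : H)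
    (hW : ∀ i, W (i + 1) = W i - η • (U i + ξ i))
    (hU : ∀ i, ‖U i - g‖ ≤ β * ‖W i - W 0‖)
    (hξ : ∀ i j, i ≠ j → inner ℝ (ξ i) (ξ j) = 0) (hgξ : ∀ i, inner ℝ g (ξ i) = 0)
    (hv : ∀ i, ‖ξ i‖ ^ 2 ≤ v) (hstep : 4 * (β ^ 2 * η ^ 2 * ((m : ℝ) * ((m : ℝ) - 1))) ≤ 1) :
    ∀ i < m, ‖W i - W 0‖ ^ 2 ≤ η ^ 2 * (2 * (i : ℝ) ^ 2 * ‖g‖ ^ 2 + 5 / 2 * (i : ℝ) * v) := by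
  have hv0 : 0 ≤ v := (sq_nonneg _).trans (hv 0)
  -- The first bracket has mutually orthogonal summands, so Pythagoras makes its noise grow like i
  -- rather than i². The gradient differences correlate with the noise and only get Cauchy–Schwarz.
  have hexp : ∀ i, W i - W 0 = -(η • (((i : ℝ) • g + ∑ l ∈ Finset.range i, ξ l)
      + ∑ l ∈ Finset.range i, (U l - g))) := by
    intro i
    induction i with
    | zero => simp
    | succ i ih =>
      rw [hW, Finset.sum_range_succ, Finset.sum_range_succ, sub_right_comm, ih]
      push_cast
      module
  intro i
  induction i using Nat.strong_induction_on with
  | _ i ih =>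
    intro him
    have hi0 : (0 : ℝ) ≤ i := Nat.cast_nonneg i
    have hi1 : (i : ℝ) + 1 ≤ m := by exact_mod_cast him
    have ha : ‖(i : ℝ) • g + ∑ l ∈ Finset.range i, ξ l‖ ^ 2 ≤ (i : ℝ) ^ 2 * ‖g‖ ^ 2 + i * v := by
      rw [norm_add_sq_real, inner_sum, Finset.sum_eq_zero, norm_smul,
        norm_sum_sq_of_pairwise_orthogonal _ _ (fun a _ c _ h => hξ a c h)]
      · have : ∑ l ∈ Finset.range i, ‖ξ l‖ ^ 2 ≤ i * v :=
          (Finset.sum_le_card_nsmul _ _ v fun l _ => hv l).trans (by simp)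
        rw [mul_pow, Real.norm_eq_abs, sq_abs]
        linarith
      · intro l _
        rw [real_inner_smul_left, hgξ, mul_zero]
    have hb : ‖∑ l ∈ Finset.range i, (U l - g)‖ ^ 2 ≤
        i * (β ^ 2 * (η ^ 2 * (2 * ‖g‖ ^ 2 * (i ^ 3 / 3) + 5 / 2 * v * (i ^ 2 / 2)))) := by
      refine (norm_sum_sq_le_card_mul _ _).trans ?_
      rw [Finset.card_range]
      gcongr
      calc ∑ l ∈ Finset.range i, ‖U l - g‖ ^ 2
          ≤ ∑ l ∈ Finset.range i,
            β ^ 2 * (η ^ 2 * (2 * (l : ℝ) ^ 2 * ‖g‖ ^ 2 + 5 / 2 * (l : ℝ) * v)) := by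
            refine Finset.sum_le_sum fun l hl => ?_
            have hl' := Finset.mem_range.1 hl
            calc ‖U l - g‖ ^ 2 ≤ (β * ‖W l - W 0‖) ^ 2 := by gcongr; exact hU l
              _ = β ^ 2 * ‖W l - W 0‖ ^ 2 := by ring
              _ ≤ _ := by gcongr; exact ih l hl' (hl'.trans him)
        _ = β ^ 2 * (η ^ 2 * (2 * ‖g‖ ^ 2 * ∑ l ∈ Finset.range i, (l : ℝ) ^ 2
            + 5 / 2 * v * ∑ l ∈ Finset.range i, (l : ℝ))) := by
            rw [← Finset.mul_sum, ← Finset.mul_sum, Finset.sum_add_distrib, Finset.mul_sum,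
              Finset.mul_sum]
            congr 3 <;> refine Finset.sum_congr rfl fun l _ => by ring
        _ ≤ _ := by
            gcongr
            · exact sum_range_cast_sq_le i
            · exact sum_range_cast_le i
    rw [hexp, norm_neg, norm_smul, mul_pow, Real.norm_eq_abs, sq_abs]
    gcongr
    -- The weight 2/5 makes the induction close with the same constants: 7/5 + 7/2 · 1/4 · 2/3 ≤ 2
    -- and 7/5 + 7/2 · 1/4 · 5/4 ≤ 5/2.
    refine (norm_add_sq_le_weighted _ _ (τ := 2 / 5) (by norm_num)).trans ?_
    -- Since i ≤ m - 1, i² ≤ m(m - 1).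
    have hs : 4 * (β ^ 2 * η ^ 2 * (i : ℝ) ^ 2) ≤ 1 := by
      refine le_trans ?_ hstep
      gcongr
      nlinarith
    have hX : i * (β ^ 2 * (η ^ 2 * (2 * ‖g‖ ^ 2 * (i ^ 3 / 3) + 5 / 2 * v * (i ^ 2 / 2)))) =
        (β ^ 2 * η ^ 2 * (i : ℝ) ^ 2) * (2 / 3 * (i ^ 2 * ‖g‖ ^ 2) + 5 / 4 * (i * v)) := by ring
    have h1 : 0 ≤ (i : ℝ) ^ 2 * ‖g‖ ^ 2 := by positivity
    have h2 : 0 ≤ (i : ℝ) * v := by positivity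
    rw [hX] at hb
    have hb' : ‖∑ l ∈ Finset.range i, (U l - g)‖ ^ 2 ≤
        1 / 4 * (2 / 3 * (i ^ 2 * ‖g‖ ^ 2) + 5 / 4 * (i * v)) := by
      refine hb.trans ?_
      gcongr
      linarith
    have hc1 : (1 : ℝ) + 2 / 5 = 7 / 5 := by norm_num
    have hc2 : (1 : ℝ) + 1 / (2 / 5) = 7 / 2 := by norm_num
    rw [hc1, hc2]
    linarith

/-- Here a, c, d, r, q stand for ‖A‖², ‖c‖², ‖A - c‖², ‖r‖², ‖r + Ξ‖², and t for ⟨A, c⟩. The left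
side is d - (1 - x)c + xq. Bounding c below by 3a/5 - 3d/2 and d + r by `hR` leaves a with
coefficient 1/6 - 7/20 · (1 - x), which is negative for x ≤ 1/2. -/
lemma energy_balance_real {x V Z a r d c q S t : ℝ} (hx0 : 0 ≤ x) (hx : x ≤ 1 / 2)
    (hV : 0 ≤ V) (hZ : 0 ≤ Z) (ha : 0 ≤ a) (hr : 0 ≤ r)
    (hR : d + r ≤ 1 / 6 * a + 2 / 3 * Z + 5 / 4 * V) (hq : q ≤ 2 * r + 2 * S)
    (hd : d = a - 2 * t + c) (hac : a ≤ 5 / 3 * c + 5 / 2 * d) :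
    a - 2 * t + x * (c + q) ≤ 4 * V + 8 * Z + 2 * x * S := by
  have f1 : x * q ≤ r + 2 * x * S := by
    have h1 := mul_le_mul_of_nonneg_left hq hx0
    have h2 := mul_le_mul_of_nonneg_right hx hr
    linarith
  have f2 := mul_le_mul_of_nonneg_left hac (by linarith : (0 : ℝ) ≤ 3 / 5 * (1 - x))
  have f3 := mul_nonneg (by linarith : (0 : ℝ) ≤ 3 / 2 * (1 - x)) hr
  have f4 := mul_le_mul_of_nonneg_left hR (by linarith : (0 : ℝ) ≤ 1 + 3 / 2 * (1 - x))
  have f5 := mul_nonneg hx0 hV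
  have f6 := mul_nonneg hx0 hZ
  have f7 := mul_nonneg (by linarith : (0 : ℝ) ≤ 1 / 2 - x) ha
  linarith

/-- Energy balance of one aggregated round of noisy local gradient descent. The subspace `C`
contains the deterministic vectors, and the noise is orthogonal to it. -/
lemma round_energy {ι : Type*} [Fintype ι] (C : Submodule ℝ H) [C.HasOrthogonalProjection]
    {η β ζ₁ ζ₂ x : ℝ} {m : ℕ} (hζ₁ : 1 ≤ ζ₁) (hζ₂ : 0 ≤ ζ₂)
    (hx0 : 0 ≤ x) (hx : x ≤ 1 / 2) (p : ι → ℝ) (hp : ∀ n, 0 ≤ p n) (hp1 : ∑ n, p n = 1)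
    (e : ι → ℕ) (he : ∀ n, 1 ≤ e n) (hem : ∀ n, e n ≤ m)
    (W U ξ : ι → ℕ → H) (g : ι → H) (v : ι → ℝ)
    (hW : ∀ n i, W n (i + 1) = W n i - η • (U n i + ξ n i))
    (hU : ∀ n i, ‖U n i - g n‖ ≤ β * ‖W n i - W n 0‖)
    (hg : ∀ n, g n ∈ C) (hξC : ∀ n i, ∀ c ∈ C, inner ℝ c (ξ n i) = 0)
    (hξ : ∀ n i n' j, (n, i) ≠ (n', j) → inner ℝ (ξ n i) (ξ n' j) = 0)
    (hv : ∀ n i, ‖ξ n i‖ ^ 2 ≤ v n)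
    (hdis : ∑ n, p n * ‖g n‖ ^ 2 ≤ ζ₁ * ‖∑ n, p n • g n‖ ^ 2 + ζ₂)
    (hstep : 4 * (ζ₁ * (β ^ 2 * η ^ 2 * ((m : ℝ) * ((m : ℝ) - 1)))) ≤ 1) :
    ‖∑ n, p n • g n‖ ^ 2
        - 2 * inner ℝ (∑ n, p n • g n) (∑ n, (p n / e n) • ∑ i ∈ Finset.range (e n), (U n i + ξ n i))
        + x * ‖∑ n, (p n / e n) • ∑ i ∈ Finset.range (e n), (U n i + ξ n i)‖ ^ 2
      ≤ 4 * (β ^ 2 * η ^ 2 * ∑ n, p n * ((e n : ℝ) - 1) * v n)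
        + 8 * (ζ₂ * (β ^ 2 * η ^ 2 * ((m : ℝ) * ((m : ℝ) - 1))))
        + 2 * x * ∑ n, p n ^ 2 / e n * v n := by
  classical
  have hepos : ∀ n, (0 : ℝ) < e n := fun n => by exact_mod_cast he n
  have hm1 : (0 : ℝ) ≤ (m : ℝ) * ((m : ℝ) - 1) := by
    rcases Nat.eq_zero_or_pos m with h | h
    · simp [h]
    · have : (1 : ℝ) ≤ m := by exact_mod_cast h
      nlinarith
  set a : ℝ := β ^ 2 * η ^ 2 * ((m : ℝ) * ((m : ℝ) - 1)) with ha
  have ha0 : 0 ≤ a := by positivity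
  set A : H := ∑ n, p n • g n with hA
  set G : H := ∑ n, (p n / e n) • ∑ i ∈ Finset.range (e n), U n i with hG
  set Ξ : H := ∑ n, (p n / e n) • ∑ i ∈ Finset.range (e n), ξ n i with hΞ
  set V : ℝ := β ^ 2 * η ^ 2 * ∑ n, p n * ((e n : ℝ) - 1) * v n with hV
  have hv0 : ∀ n, 0 ≤ v n := fun n => (sq_nonneg _).trans (hv n 0)
  have hV0 : 0 ≤ V := by
    refine mul_nonneg (by positivity) (Finset.sum_nonneg fun n _ => ?_)
    have : (1 : ℝ) ≤ e n := by exact_mod_cast he n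
    exact mul_nonneg (mul_nonneg (hp n) (by linarith)) (hv0 n)
  have hsplit : ∑ n, (p n / e n) • ∑ i ∈ Finset.range (e n), (U n i + ξ n i) = G + Ξ := by
    rw [hG, hΞ, ← Finset.sum_add_distrib]
    exact Finset.sum_congr rfl fun n _ => by rw [Finset.sum_add_distrib, smul_add]
  rw [hsplit]
  -- the noise
  have hΞC : ∀ c ∈ C, inner ℝ c Ξ = 0 := by
    intro c hc
    rw [hΞ, inner_sum]
    refine Finset.sum_eq_zero fun n _ => ?_
    rw [real_inner_smul_right, inner_sum, Finset.sum_eq_zero fun i _ => hξC n i c hc, mul_zero]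
  have hΞn : ‖Ξ‖ ^ 2 ≤ ∑ n, p n ^ 2 / e n * v n := by
    rw [hΞ, norm_sum_sq_of_pairwise_orthogonal]
    · refine Finset.sum_le_sum fun n _ => ?_
      rw [norm_smul, mul_pow, Real.norm_eq_abs, sq_abs, norm_sum_sq_of_pairwise_orthogonal]
      · have : ∑ i ∈ Finset.range (e n), ‖ξ n i‖ ^ 2 ≤ e n * v n :=
          (Finset.sum_le_card_nsmul _ _ (v n) fun l _ => hv n l).trans (by simp)
        calc (p n / e n) ^ 2 * ∑ i ∈ Finset.range (e n), ‖ξ n i‖ ^ 2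
            ≤ (p n / e n) ^ 2 * (e n * v n) := by gcongr
          _ = _ := by have := (hepos n).ne'; field_simp
      · exact fun i _ j _ hij => hξ n i n j (by simpa using hij)
    · intro n _ n' _ hnn
      rw [real_inner_smul_left, real_inner_smul_right, sum_inner, Finset.sum_eq_zero]
      · simp
      · intro i _
        rw [inner_sum]
        exact Finset.sum_eq_zero fun j _ => hξ n i n' j (by simp [hnn])
  -- the drift
  have hR : ‖A - G‖ ^ 2 ≤ 2 / 3 * (a * (ζ₁ * ‖A‖ ^ 2 + ζ₂)) + 5 / 4 * V := by
    have hAG : A - G = ∑ n, p n • ((1 / (e n : ℝ)) • ∑ i ∈ Finset.range (e n), (g n - U n i)) := by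
      rw [hA, hG, ← Finset.sum_sub_distrib]
      refine Finset.sum_congr rfl fun n _ => ?_
      rw [Finset.sum_sub_distrib, Finset.sum_const, Finset.card_range, smul_sub, smul_sub,
        ← Nat.cast_smul_eq_nsmul ℝ, smul_smul, smul_smul, smul_smul, mul_one_div,
        div_mul_cancel₀ _ (hepos n).ne']
    rw [hAG]
    refine (norm_weighted_sum_sq_le _ p (fun n _ => hp n) hp1 _).trans ?_
    have hn : ∀ n, ‖(1 / (e n : ℝ)) • ∑ i ∈ Finset.range (e n), (g n - U n i)‖ ^ 2 ≤
        2 / 3 * (a * ‖g n‖ ^ 2) + 5 / 4 * (β ^ 2 * η ^ 2 * (((e n : ℝ) - 1) * v n)) := by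
      intro n
      have he1 : (1 : ℝ) ≤ e n := by exact_mod_cast he n
      have hemr : (e n : ℝ) ≤ m := by exact_mod_cast hem n
      -- The gradient term must be made uniform in n for the dissimilarity bound to apply; the noise
      -- term keeps its own e n - 1.
      have hmm : (e n : ℝ) * ((e n : ℝ) - 1) ≤ (m : ℝ) * ((m : ℝ) - 1) := by nlinarith
      have hst : 4 * (β ^ 2 * η ^ 2 * ((e n : ℝ) * ((e n : ℝ) - 1))) ≤ 1 := by
        refine le_trans ?_ hstep
        have : β ^ 2 * η ^ 2 * ((e n : ℝ) * ((e n : ℝ) - 1)) ≤ a := by rw [ha]; gcongr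
        nlinarith
      have hd := local_drift (W n) (U n) (ξ n) (g n) (hW n) (hU n)
        (fun i j h => hξ n i n j (by simpa using h)) (fun i => hξC n i _ (hg n)) (hv n) hst
      rw [norm_smul, mul_pow]
      have h1 : ‖∑ i ∈ Finset.range (e n), (g n - U n i)‖ ^ 2 ≤ e n * (β ^ 2 * (η ^ 2 *
          (2 * ‖g n‖ ^ 2 * ((e n : ℝ) * ((e n : ℝ) * ((e n : ℝ) - 1)) / 3)
            + 5 / 2 * v n * ((e n : ℝ) * ((e n : ℝ) - 1) / 2)))) := by
        refine (norm_sum_sq_le_card_mul _ _).trans ?_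
        rw [Finset.card_range]
        gcongr
        calc ∑ l ∈ Finset.range (e n), ‖g n - U n l‖ ^ 2
            ≤ ∑ l ∈ Finset.range (e n),
              β ^ 2 * (η ^ 2 * (2 * (l : ℝ) ^ 2 * ‖g n‖ ^ 2 + 5 / 2 * (l : ℝ) * v n)) := by
              refine Finset.sum_le_sum fun l hl => ?_
              rw [norm_sub_rev]
              calc ‖U n l - g n‖ ^ 2 ≤ (β * ‖W n l - W n 0‖) ^ 2 := by gcongr; exact hU n l
                _ = β ^ 2 * ‖W n l - W n 0‖ ^ 2 := by ring
                _ ≤ _ := by gcongr; exact hd l (Finset.mem_range.1 hl)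
          _ = β ^ 2 * (η ^ 2 * (2 * ‖g n‖ ^ 2 * ∑ l ∈ Finset.range (e n), (l : ℝ) ^ 2
              + 5 / 2 * v n * ∑ l ∈ Finset.range (e n), (l : ℝ))) := by
              rw [← Finset.mul_sum, ← Finset.mul_sum, Finset.sum_add_distrib, Finset.mul_sum,
                Finset.mul_sum]
              congr 3 <;> refine Finset.sum_congr rfl fun l _ => by ring
          _ ≤ _ := by
              have := hv0 n
              gcongr
              · exact sum_range_cast_sq_le' (e n)
              · exact (sum_range_cast_eq (e n)).le
      have hne := (hepos n).ne'
      calc ‖1 / (e n : ℝ)‖ ^ 2 * ‖∑ i ∈ Finset.range (e n), (g n - U n i)‖ ^ 2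
          ≤ ‖1 / (e n : ℝ)‖ ^ 2 * (e n * (β ^ 2 * (η ^ 2 *
          (2 * ‖g n‖ ^ 2 * ((e n : ℝ) * ((e n : ℝ) * ((e n : ℝ) - 1)) / 3)
            + 5 / 2 * v n * ((e n : ℝ) * ((e n : ℝ) - 1) / 2))))) := by gcongr
        _ = 2 / 3 * (β ^ 2 * η ^ 2 * ((e n : ℝ) * ((e n : ℝ) - 1)) * ‖g n‖ ^ 2)
            + 5 / 4 * (β ^ 2 * η ^ 2 * (((e n : ℝ) - 1) * v n)) := by
            rw [Real.norm_eq_abs, sq_abs]; field_simp; ring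
        _ ≤ _ := by rw [ha]; gcongr
    calc ∑ n, p n * ‖(1 / (e n : ℝ)) • ∑ i ∈ Finset.range (e n), (g n - U n i)‖ ^ 2
        ≤ ∑ n, p n * (2 / 3 * (a * ‖g n‖ ^ 2)
            + 5 / 4 * (β ^ 2 * η ^ 2 * (((e n : ℝ) - 1) * v n))) :=
          Finset.sum_le_sum fun n _ => mul_le_mul_of_nonneg_left (hn n) (hp n)
      _ = 2 / 3 * (a * ∑ n, p n * ‖g n‖ ^ 2) + 5 / 4 * V := by
          rw [hV, Finset.mul_sum, Finset.mul_sum, Finset.mul_sum, Finset.mul_sum,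
            ← Finset.sum_add_distrib]
          exact Finset.sum_congr rfl fun n _ => by ring
      _ ≤ _ := by gcongr
  -- decomposition along `C`
  set c : H := C.starProjection G with hc
  have hcC : c ∈ C := Submodule.starProjection_apply_mem C G
  have hAC : A ∈ C := Submodule.sum_mem _ fun n _ => C.smul_mem _ (hg n)
  set r : H := G - c with hr
  have hrC : ∀ y ∈ C, inner ℝ y r = 0 := fun y hy =>
    (Submodule.mem_orthogonal C r).1 (Submodule.sub_starProjection_mem_orthogonal G) y hy
  have hGr : G = c + r := by rw [hr]; abel
  have e1 : ‖A - G‖ ^ 2 = ‖A - c‖ ^ 2 + ‖r‖ ^ 2 := by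
    have : A - G = (A - c) - r := by rw [hGr]; abel
    rw [this, norm_sub_sq_real, hrC _ (C.sub_mem hAC hcC)]; ring
  have e2 : inner ℝ A (G + Ξ) = inner ℝ A c := by
    rw [hGr, inner_add_right, inner_add_right, hrC A hAC, hΞC A hAC]; ring
  have e3 : ‖G + Ξ‖ ^ 2 = ‖c‖ ^ 2 + ‖r + Ξ‖ ^ 2 := by
    rw [hGr, add_assoc, norm_add_sq_real, inner_add_right, hrC c hcC, hΞC c hcC]; ring
  have e4 : ‖r + Ξ‖ ^ 2 ≤ 2 * ‖r‖ ^ 2 + 2 * ‖Ξ‖ ^ 2 := by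
    have := norm_add_sq_le_weighted r Ξ (τ := 1) one_pos
    linarith
  have e5 : ‖A - c‖ ^ 2 = ‖A‖ ^ 2 - 2 * inner ℝ A c + ‖c‖ ^ 2 := norm_sub_sq_real A c
  have e6 : ‖A‖ ^ 2 ≤ 5 / 3 * ‖c‖ ^ 2 + 5 / 2 * ‖A - c‖ ^ 2 := by
    -- This weight gives the factors 5/3 and 5/2 that `energy_balance_real` expects.
    have := norm_add_sq_le_weighted c (A - c) (τ := 2 / 3) (by norm_num)
    rw [add_sub_cancel] at this
    linarith
  rw [e2, e3]
  -- The coefficient is 1/6 = 2/3 · 1/4, because ζ₁a ≤ 1/4 by `hstep`.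
  have hR' : ‖A - c‖ ^ 2 + ‖r‖ ^ 2 ≤ 1 / 6 * ‖A‖ ^ 2 + 2 / 3 * (ζ₂ * a) + 5 / 4 * V := by
    rw [← e1]
    have h1 := mul_le_mul_of_nonneg_right hstep (sq_nonneg ‖A‖)
    linarith
  have hζa : 0 ≤ ζ₂ * a := mul_nonneg hζ₂ ha0
  have e7 : ‖r + Ξ‖ ^ 2 ≤ 2 * ‖r‖ ^ 2 + 2 * ∑ n, p n ^ 2 / e n * v n := by linarith
  exact energy_balance_real hx0 hx hV0 hζa (sq_nonneg ‖A‖) (sq_nonneg ‖r‖) hR' e7 e5 e6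

end Hilbert

/-! ### Freezing independent coordinates. -/

section Independence

variable {ι : Type*} {α : ι → Type*}

/-- A function that depends on finitely many coordinates factors through their tuple. -/
lemma DependsOn.exists_factor {V : Type*} {S : Finset ι} {Z : (∀ i, α i) → V}
    (hZ : DependsOn Z (S : Set ι)) (x₀ : ∀ i, α i) :
    ∃ φ : (∀ i : S, α i) → V, ∀ x, Z x = φ fun i => x i := by
  classical
  exact ⟨fun y => Z fun i => if h : i ∈ S then y ⟨i, h⟩ else x₀ i, fun x => hZ fun i hi => by
    simp [Finset.mem_coe.1 hi]⟩

variable [∀ i, MeasurableSpace (α i)] [∀ i, Finite (α i)] [∀ i, DiscreteMeasurableSpace (α i)]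
  {Ω : Type*} [MeasurableSpace Ω] {μ : Measure Ω} [IsProbabilityMeasure μ] {Y : ∀ i, Ω → α i}

omit [∀ i, Finite (α i)] [∀ i, DiscreteMeasurableSpace (α i)] [IsProbabilityMeasure μ] in
lemma measurable_tuple (hY : ∀ i, Measurable (Y i)) (S : Finset ι) :
    Measurable fun s (i : S) => Y i s :=
  measurable_pi_lambda _ fun i => hY i

/-- Finitely many coordinates with finite discrete values take finitely many joint values, so no
measurability of `Z` is needed; in particular none of the loss or its gradient. -/
lemma integrable_of_dependsOn (hY : ∀ i, Measurable (Y i)) {E : Type*} [NormedAddCommGroup E]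
    {S : Finset ι} {Z : (∀ i, α i) → E} (hZ : DependsOn Z (S : Set ι)) :
    Integrable (fun s => Z fun i => Y i s) μ := by
  obtain ⟨s₀⟩ := nonempty_of_isProbabilityMeasure μ
  obtain ⟨φ, hφ⟩ := hZ.exists_factor fun i => Y i s₀
  have hm := measurable_tuple hY S
  have : IsProbabilityMeasure (μ.map fun s (i : S) => Y i s) :=
    Measure.isProbabilityMeasure_map hm.aemeasurable
  have h := (Integrable.of_finite (μ := μ.map fun s (i : S) => Y i s) (f := φ)).comp_measurable hm
  refine h.congr (.of_forall fun s => ?_)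
  exact (hφ fun i => Y i s).symm

/-- Integrating out the coordinates of `T`, which are independent of those of `S`. -/
lemma integral_dependsOn_eq_integral_integral (hY : ∀ i, Measurable (Y i))
    (hind : iIndepFun Y μ) {S T : Finset ι} (hST : Disjoint S T) {V : Type*}
    {Z : (∀ i, α i) → V} (hZ : DependsOn Z (S : Set ι))
    {F : V → (∀ i, α i) → ℝ} (hF : ∀ v, DependsOn (F v) (T : Set ι)) :
    ∫ s, F (Z fun i => Y i s) (fun i => Y i s) ∂μ =
      ∫ s, ∫ s', F (Z fun i => Y i s) (fun i => Y i s') ∂μ ∂μ := by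
  obtain ⟨s₀⟩ := nonempty_of_isProbabilityMeasure μ
  obtain ⟨φ, hφ⟩ := hZ.exists_factor fun i => Y i s₀
  choose ψ hψ using fun v => (hF v).exists_factor fun i => Y i s₀
  have hS := measurable_tuple hY S
  have hT := measurable_tuple hY T
  have := Measure.isProbabilityMeasure_map (μ := μ) hS.aemeasurable
  have := Measure.isProbabilityMeasure_map (μ := μ) hT.aemeasurable
  have hprod := (indepFun_iff_map_prod_eq_prod_map_map hS.aemeasurable hT.aemeasurable).1
    (hind.indepFun_finset S T hST hY)
  simp only [hψ, hφ]
  calc ∫ s, ψ (φ fun i : S => Y i s) (fun i : T => Y i s) ∂μ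
      = ∫ q, ψ (φ q.1) q.2 ∂(μ.map fun s => ((fun i : S => Y i s), fun i : T => Y i s)) :=
        (integral_map (f := fun q : (∀ i : S, α i) × (∀ i : T, α i) => ψ (φ q.1) q.2)
          (hS.prodMk hT).aemeasurable .of_discrete).symm
    _ = ∫ a, ∫ c, ψ (φ a) c ∂(μ.map fun s (i : T) => Y i s) ∂(μ.map fun s (i : S) => Y i s) := by
        rw [hprod, integral_prod _ Integrable.of_finite]
    _ = ∫ s, ∫ c, ψ (φ fun i : S => Y i s) c ∂(μ.map fun s (i : T) => Y i s) ∂μ :=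
        integral_map hS.aemeasurable .of_discrete
    _ = _ := by
        refine integral_congr_ae (.of_forall fun s => ?_)
        exact integral_map hT.aemeasurable .of_discrete

end Independence

/-! ### Sampling without replacement. -/

section SampleVariance

variable {X : Type*} [DecidableEq X] {E : Type*} [NormedAddCommGroup E] [InnerProductSpace ℝ E]

lemma card_filter_mem_powersetCard {S : Finset X} {d : X} (hd : d ∈ S) {B : ℕ} (hB : 1 ≤ B) :
    (S.card : ℝ) * (((S.powersetCard B).filter (d ∈ ·)).card : ℝ) =
      B * (S.card.choose B : ℝ) := by
  have h : (S.powersetCard B).filter (d ∈ ·) = (S.powersetCard B).filter ({d} ⊆ ·) := by simp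
  rw [h, Finset.card_filter_powersetCard_subset {d} S B (by simpa) (by simpa), Finset.card_singleton]
  obtain ⟨B, rfl⟩ := Nat.exists_eq_add_of_le' hB
  obtain ⟨s, hs⟩ := Nat.exists_eq_add_of_le' (Finset.card_pos.2 ⟨d, hd⟩)
  rw [hs]
  have := Nat.add_one_mul_choose_eq s B
  simp only [Nat.add_sub_cancel]
  rw [mul_comm (((B + 1 : ℕ)) : ℝ)]
  exact_mod_cast this

lemma card_filter_mem_mem_powersetCard {S : Finset X} {d d' : X} (hd : d ∈ S) (hd' : d' ∈ S)
    (hne : d ≠ d') {B : ℕ} (hB : 1 ≤ B) :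
    (S.card : ℝ) * ((S.card : ℝ) - 1) *
        (((S.powersetCard B).filter fun A => d ∈ A ∧ d' ∈ A).card : ℝ) =
      B * ((B : ℝ) - 1) * (S.card.choose B : ℝ) := by
  have h : (S.powersetCard B).filter (fun A => d ∈ A ∧ d' ∈ A) =
      (S.powersetCard B).filter ({d, d'} ⊆ ·) := by simp [Finset.insert_subset_iff]
  have hsub : {d, d'} ⊆ S := by simp [Finset.insert_subset_iff, hd, hd']
  -- A sample of size 1 contains no pair, and the right side vanishes too; the counting formula
  -- needs size at least 2.
  rcases hB.eq_or_lt with rfl | hB2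
  · have : (S.powersetCard 1).filter (fun A => d ∈ A ∧ d' ∈ A) = ∅ := by
      refine Finset.filter_eq_empty_iff.2 fun A hA hdd => hne ?_
      exact Finset.card_le_one.1 (Finset.mem_powersetCard.1 hA).2.le d hdd.1 d' hdd.2
    simp [this]
  · rw [h, Finset.card_filter_powersetCard_subset {d, d'} S B hsub
      (by rw [Finset.card_pair hne]; exact hB2), Finset.card_pair hne]
    have h2 : 2 ≤ S.card := by rw [← Finset.card_pair hne]; exact Finset.card_le_card hsub
    obtain ⟨B, rfl⟩ := Nat.exists_eq_add_of_le' hB2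
    obtain ⟨s, hs⟩ := Nat.exists_eq_add_of_le' h2
    rw [hs]
    have e1 : ((s + 1 + 1 : ℕ) : ℝ) * ((s + 1).choose (B + 1) : ℝ) =
        ((s + 1 + 1).choose (B + 1 + 1) : ℝ) * ((B + 1 + 1 : ℕ) : ℝ) := by
      exact_mod_cast Nat.add_one_mul_choose_eq (s + 1) (B + 1)
    have e2 : ((s + 1 : ℕ) : ℝ) * (s.choose B : ℝ) =
        ((s + 1).choose (B + 1) : ℝ) * ((B + 1 : ℕ) : ℝ) := by
      exact_mod_cast Nat.add_one_mul_choose_eq s B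
    simp only [Nat.add_sub_cancel]
    change ((s + 1 + 1 : ℕ) : ℝ) * (((s + 1 + 1 : ℕ) : ℝ) - 1) * (s.choose B : ℝ) =
      ((B + 1 + 1 : ℕ) : ℝ) * (((B + 1 + 1 : ℕ) : ℝ) - 1) * ((s + 1 + 1).choose (B + 1 + 1) : ℝ)
    push_cast at e1 e2 ⊢
    linear_combination ((s : ℝ) + 1 + 1) * e2 + ((B : ℝ) + 1) * e1

lemma sum_powersetCard_sum (S : Finset X) {B : ℕ} (hB : 1 ≤ B) (y : X → E) :
    (S.card : ℝ) • ∑ A ∈ S.powersetCard B, ∑ d ∈ A, y d =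
      ((B : ℝ) * (S.card.choose B : ℝ)) • ∑ d ∈ S, y d := by
  have h : ∑ A ∈ S.powersetCard B, ∑ d ∈ A, y d =
      ∑ d ∈ S, (((S.powersetCard B).filter (d ∈ ·)).card : ℝ) • y d := by
    have h1 : ∀ A ∈ S.powersetCard B, ∑ d ∈ A, y d = ∑ d ∈ S, if d ∈ A then y d else 0 := by
      intro A hA
      rw [← Finset.sum_filter, Finset.filter_mem_eq_inter,
        Finset.inter_eq_right.2 (Finset.mem_powersetCard.1 hA).1]
    rw [Finset.sum_congr rfl h1, Finset.sum_comm]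
    refine Finset.sum_congr rfl fun d _ => ?_
    rw [← Finset.sum_filter, Finset.sum_const, Nat.cast_smul_eq_nsmul]
  rw [h, Finset.smul_sum, Finset.smul_sum]
  exact Finset.sum_congr rfl fun d hd => by rw [smul_smul, card_filter_mem_powersetCard hd hB]

/-- Second moment of the sum of a uniform sample without replacement from a centred family. -/
lemma sum_powersetCard_norm_sq (S : Finset X) {B : ℕ} (hB : 1 ≤ B) (y : X → E)
    (hy : ∑ d ∈ S, y d = 0) :
    (S.card : ℝ) * ((S.card : ℝ) - 1) * ∑ A ∈ S.powersetCard B, ‖∑ d ∈ A, y d‖ ^ 2 =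
      (B : ℝ) * ((S.card : ℝ) - B) * (S.card.choose B : ℝ) * ∑ d ∈ S, ‖y d‖ ^ 2 := by
  have h1 : ∀ A ∈ S.powersetCard B, ‖∑ d ∈ A, y d‖ ^ 2 =
      ∑ d ∈ S, ∑ d' ∈ S, if d ∈ A ∧ d' ∈ A then inner ℝ (y d) (y d') else 0 := by
    intro A hA
    have hA' := Finset.inter_eq_right.2 (Finset.mem_powersetCard.1 hA).1
    rw [← real_inner_self_eq_norm_sq, sum_inner]
    conv_lhs => rw [← hA', ← Finset.filter_mem_eq_inter, Finset.sum_filter]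
    refine Finset.sum_congr rfl fun d _ => ?_
    by_cases hd : d ∈ A
    · simp only [hd, if_true, true_and]
      rw [← Finset.sum_filter, inner_sum]
    · simp [hd]
  have h2 : ∀ d ∈ S, ∀ d' ∈ S, (S.card : ℝ) * ((S.card : ℝ) - 1) *
      ∑ A ∈ S.powersetCard B, (if d ∈ A ∧ d' ∈ A then inner ℝ (y d) (y d') else 0) =
      B * ((B : ℝ) - 1) * (S.card.choose B : ℝ) * inner ℝ (y d) (y d') +
      if d = d' then (B : ℝ) * ((S.card : ℝ) - B) * (S.card.choose B : ℝ) * ‖y d‖ ^ 2 else 0 := by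
    intro d hd d' hd'
    rw [← Finset.sum_filter, Finset.sum_const, nsmul_eq_mul, ← mul_assoc]
    by_cases hne : d = d'
    · subst hne
      have := card_filter_mem_powersetCard hd hB
      simp only [and_self, if_true, real_inner_self_eq_norm_sq]
      linear_combination ((S.card : ℝ) - 1) * ‖y d‖ ^ 2 * this
    · rw [card_filter_mem_mem_powersetCard hd hd' hne hB, if_neg hne, add_zero]
  rw [Finset.sum_congr rfl h1, Finset.sum_comm, Finset.mul_sum]
  have h3 : ∀ d ∈ S, (S.card : ℝ) * ((S.card : ℝ) - 1) * ∑ A ∈ S.powersetCard B,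
      ∑ d' ∈ S, (if d ∈ A ∧ d' ∈ A then inner ℝ (y d) (y d') else 0) =
      (B : ℝ) * ((S.card : ℝ) - B) * (S.card.choose B : ℝ) * ‖y d‖ ^ 2 := by
    intro d hd
    rw [Finset.sum_comm, Finset.mul_sum, Finset.sum_congr rfl (h2 d hd), Finset.sum_add_distrib,
      ← Finset.mul_sum, ← inner_sum, hy, inner_zero_right, mul_zero, zero_add]
    simp [hd]
  rw [Finset.sum_congr rfl h3, ← Finset.mul_sum]

omit [DecidableEq X] in
/-- The sum of squared deviations from the mean, in terms of pairwise distances. -/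
lemma sum_sum_norm_sub_sq (S : Finset X) (hS : S.Nonempty) (u : X → E) :
    ∑ d ∈ S, ∑ d' ∈ S, ‖u d - u d'‖ ^ 2 =
      2 * (S.card : ℝ) * ∑ d ∈ S, ‖u d - (1 / (S.card : ℝ)) • ∑ c ∈ S, u c‖ ^ 2 := by
  have hc : (S.card : ℝ) ≠ 0 := by exact_mod_cast hS.card_pos.ne'
  set m := (1 / (S.card : ℝ)) • ∑ c ∈ S, u c with hm
  have h0 : ∑ d ∈ S, (u d - m) = 0 := by
    rw [Finset.sum_sub_distrib, Finset.sum_const, ← Nat.cast_smul_eq_nsmul ℝ, hm, smul_smul,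
      mul_one_div_cancel hc, one_smul, sub_self]
  have h1 : ∀ d d', ‖u d - u d'‖ ^ 2 =
      ‖u d - m‖ ^ 2 - 2 * inner ℝ (u d - m) (u d' - m) + ‖u d' - m‖ ^ 2 := fun d d' => by
    rw [← norm_sub_sq_real, sub_sub_sub_cancel_right]
  simp_rw [h1, Finset.sum_add_distrib, Finset.sum_sub_distrib, ← Finset.mul_sum, ← inner_sum, h0]
  simp only [inner_zero_right, Finset.sum_const, nsmul_eq_mul, ← Finset.mul_sum]
  ring

omit [DecidableEq X] in
-- The hypothesis compares pairwise distances only; writing both variances as sums over pairs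
-- removes the means.
lemma sum_deviation_sq_le {E' : Type*} [NormedAddCommGroup E'] [InnerProductSpace ℝ E']
    (S : Finset X) {θ : ℝ} (u : X → E) (u' : X → E')
    (h : ∀ d ∈ S, ∀ d' ∈ S, ‖u d - u d'‖ ≤ θ * ‖u' d - u' d'‖) :
    ∑ d ∈ S, ‖u d - (1 / (S.card : ℝ)) • ∑ c ∈ S, u c‖ ^ 2 ≤
      θ ^ 2 * ∑ d ∈ S, ‖u' d - (1 / (S.card : ℝ)) • ∑ c ∈ S, u' c‖ ^ 2 := by
  rcases S.eq_empty_or_nonempty with rfl | hS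
  · simp
  have hc : (0 : ℝ) < S.card := by exact_mod_cast hS.card_pos
  have h1 : ∑ d ∈ S, ∑ d' ∈ S, ‖u d - u d'‖ ^ 2 ≤
      θ ^ 2 * ∑ d ∈ S, ∑ d' ∈ S, ‖u' d - u' d'‖ ^ 2 := by
    simp_rw [Finset.mul_sum, ← mul_pow]
    refine Finset.sum_le_sum fun d hd => Finset.sum_le_sum fun d' hd' => ?_
    exact pow_le_pow_left₀ (norm_nonneg _) (h d hd d' hd') 2
  rw [sum_sum_norm_sub_sq S hS u, sum_sum_norm_sub_sq S hS u'] at h1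
  nlinarith

/-- The error of the rescaled sum over a uniform sample without replacement. -/
noncomputable def sampleError (S : Finset X) (B : ℕ) (u : X → E) (A : Finset X) : E :=
  ((S.card : ℝ) / B) • ∑ d ∈ A, u d - ∑ d ∈ S, u d

lemma sum_sampleError (S : Finset X) {B : ℕ} (hB : 1 ≤ B) (u : X → E) :
    ∑ A ∈ S.powersetCard B, sampleError S B u A = 0 := by
  have hB0 : (B : ℝ) ≠ 0 := by exact_mod_cast (by omega : B ≠ 0)
  have h := sum_powersetCard_sum S hB u
  unfold sampleError
  rw [Finset.sum_sub_distrib, ← Finset.smul_sum, div_eq_inv_mul, mul_smul, h, smul_smul,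
    Finset.sum_const, Finset.card_powersetCard, inv_mul_cancel_left₀ hB0, Nat.cast_smul_eq_nsmul,
    sub_self]

/-- The exact second moment has the finite-population factor s/(s - 1), with s the stratum size. It
is bounded by 2 for s ≥ 2, and this is the 2 in front of θ². -/
lemma sum_sampleError_sq_le {E' : Type*} [NormedAddCommGroup E'] [InnerProductSpace ℝ E']
    (S : Finset X) {B : ℕ} (hB : 1 ≤ B) (hBS : B ≤ S.card) {θ : ℝ}
    (u : X → E) (u' : X → E') (h : ∀ d ∈ S, ∀ d' ∈ S, ‖u d - u d'‖ ≤ θ * ‖u' d - u' d'‖) :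
    ∑ A ∈ S.powersetCard B, ‖sampleError S B u A‖ ^ 2 ≤
      (S.card.choose B : ℝ) * (2 * θ ^ 2 * (((S.card : ℝ) - B) / B *
        ∑ d ∈ S, ‖u' d - (1 / (S.card : ℝ)) • ∑ c ∈ S, u' c‖ ^ 2)) := by
  have hB0 : (0 : ℝ) < B := by exact_mod_cast (by omega : 0 < B)
  have hs0 : (0 : ℝ) < S.card := by exact_mod_cast (by omega : 0 < S.card)
  have hBs : (B : ℝ) ≤ S.card := by exact_mod_cast hBS
  set m := (1 / (S.card : ℝ)) • ∑ c ∈ S, u c with hm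
  have hsm : (S.card : ℝ) • m = ∑ c ∈ S, u c := by
    rw [hm, smul_smul, mul_one_div_cancel hs0.ne', one_smul]
  have h0 : ∑ d ∈ S, (u d - m) = 0 := by
    rw [Finset.sum_sub_distrib, Finset.sum_const, ← Nat.cast_smul_eq_nsmul ℝ, hsm, sub_self]
  have hz : ∀ A ∈ S.powersetCard B,
      sampleError S B u A = ((S.card : ℝ) / B) • ∑ d ∈ A, (u d - m) := by
    intro A hA
    rw [sampleError, Finset.sum_sub_distrib, Finset.sum_const, (Finset.mem_powersetCard.1 hA).2,
      smul_sub, ← Nat.cast_smul_eq_nsmul ℝ, smul_smul, div_mul_cancel₀ _ hB0.ne', hsm]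
  set Q := ∑ d ∈ S, ‖u d - m‖ ^ 2
  set Q' := ∑ d ∈ S, ‖u' d - (1 / (S.card : ℝ)) • ∑ c ∈ S, u' c‖ ^ 2
  have hQ : Q ≤ θ ^ 2 * Q' := sum_deviation_sq_le S u u' h
  have hsum : ∑ A ∈ S.powersetCard B, ‖sampleError S B u A‖ ^ 2 =
      ((S.card : ℝ) / B) ^ 2 * ∑ A ∈ S.powersetCard B, ‖∑ d ∈ A, (u d - m)‖ ^ 2 := by
    rw [Finset.mul_sum]
    refine Finset.sum_congr rfl fun A hA => ?_
    rw [hz A hA, norm_smul, mul_pow, Real.norm_eq_abs, sq_abs]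
  have key := sum_powersetCard_norm_sq S hB (fun d => u d - m) h0
  rw [hsum]
  set P := ∑ A ∈ S.powersetCard B, ‖∑ d ∈ A, (u d - m)‖ ^ 2
  have hC0 : (0 : ℝ) ≤ S.card.choose B := Nat.cast_nonneg _
  have hQ0 : 0 ≤ Q := Finset.sum_nonneg fun _ _ => sq_nonneg _
  -- For a singleton the factor s/(s - 1) is meaningless, but the sample is the whole stratum and
  -- the error is zero.
  rcases (show 1 ≤ S.card by omega).eq_or_lt with h1 | h2
  · have hB1 : B = S.card := by omega
    have hP : P = 0 := by
      refine Finset.sum_eq_zero fun A hA => ?_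
      have : A = S := Finset.eq_of_subset_of_card_le (Finset.mem_powersetCard.1 hA).1
        (by rw [(Finset.mem_powersetCard.1 hA).2, hB1])
      rw [this, h0]; simp
    rw [hP, hB1]; simp
  · have hs2 : (2 : ℝ) ≤ S.card := by exact_mod_cast h2
    set s : ℝ := (S.card : ℝ)
    set b : ℝ := (B : ℝ)
    set C : ℝ := (S.card.choose B : ℝ)
    have hP : P = b * (s - b) * C * Q / (s * (s - 1)) := by
      rw [eq_div_iff (by nlinarith)]
      linarith
    have hss : s / (s - 1) ≤ 2 := by rw [div_le_iff₀ (by linarith)]; linarith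
    have hs1 : s - 1 ≠ 0 := by linarith
    calc (s / b) ^ 2 * P = C * ((s / (s - 1)) * ((s - b) / b * Q)) := by
          rw [hP]; field_simp
      _ ≤ C * (2 * ((s - b) / b * (θ ^ 2 * Q'))) := by
          have : 0 ≤ (s - b) / b := div_nonneg (by linarith) hB0.le
          gcongr
      _ = _ := by ring

end SampleVariance

/-! ### Transfer of the round estimate to random vectors. -/

section SquareIntegrable

variable {Ω : Type*} [MeasurableSpace Ω] {E : Type*} [NormedAddCommGroup E] [InnerProductSpace ℝ E]

/-- The space of square integrable functions, before passing to classes. -/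
def squareIntegrable (μ : Measure Ω) : Submodule ℝ (Ω → E) where
  carrier := {f | MemLp f 2 μ}
  add_mem' := MemLp.add
  zero_mem' := MemLp.zero
  smul_mem' c _ hf := hf.const_smul c

/-- The class in `L²` of a square integrable function. -/
noncomputable def squareIntegrableToLp (μ : Measure Ω) :
    squareIntegrable (E := E) μ →ₗ[ℝ] Lp E 2 μ where
  toFun f := MemLp.toLp f.1 f.2
  map_add' _ _ := rfl
  map_smul' _ _ := rfl

lemma inner_squareIntegrableToLp {μ : Measure Ω} (f g : squareIntegrable (E := E) μ) :
    inner ℝ (squareIntegrableToLp μ f) (squareIntegrableToLp μ g) =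
      ∫ s, inner ℝ (f.1 s) (g.1 s) ∂μ := by
  rw [L2.inner_def]
  refine integral_congr_ae ?_
  filter_upwards [f.2.coeFn_toLp, g.2.coeFn_toLp] with s hf hg
  change inner ℝ (f.2.toLp f.1 s) (g.2.toLp g.1 s) = _
  rw [hf, hg]

lemma norm_sq_squareIntegrableToLp {μ : Measure Ω} (f : squareIntegrable (E := E) μ) :
    ‖squareIntegrableToLp μ f‖ ^ 2 = ∫ s, ‖f.1 s‖ ^ 2 ∂μ := by
  rw [← real_inner_self_eq_norm_sq, inner_squareIntegrableToLp]
  simp_rw [real_inner_self_eq_norm_sq]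

/-- The constants inside the square integrable functions. -/
def constSquareIntegrable (μ : Measure Ω) [IsFiniteMeasure μ] :
    E →ₗ[ℝ] squareIntegrable (E := E) μ where
  toFun c := ⟨fun _ => c, memLp_const c⟩
  map_add' _ _ := rfl
  map_smul' _ _ := rfl

/-- `round_energy` for random vectors. -/
lemma integral_round_energy [FiniteDimensional ℝ E] {μ : Measure Ω} [IsProbabilityMeasure μ]
    {ι : Type*} [Fintype ι] {η β ζ₁ ζ₂ x : ℝ} {m : ℕ} (hβ : 0 ≤ β) (hζ₁ : 1 ≤ ζ₁) (hζ₂ : 0 ≤ ζ₂)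
    (hx0 : 0 ≤ x) (hx : x ≤ 1 / 2) (p : ι → ℝ) (hp : ∀ n, 0 ≤ p n) (hp1 : ∑ n, p n = 1)
    (e : ι → ℕ) (he : ∀ n, 1 ≤ e n) (hem : ∀ n, e n ≤ m)
    (W U ξ : ι → ℕ → Ω → E) (g : ι → E) (v : ι → ℝ)
    (hWm : ∀ n i, MemLp (W n i) 2 μ) (hUm : ∀ n i, MemLp (U n i) 2 μ)
    (hξm : ∀ n i, MemLp (ξ n i) 2 μ)
    (hW : ∀ n i s, W n (i + 1) s = W n i s - η • (U n i s + ξ n i s))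
    (hU : ∀ n i s, ‖U n i s - g n‖ ≤ β * ‖W n i s - W n 0 s‖)
    (hξ0 : ∀ n i c, ∫ s, inner ℝ c (ξ n i s) ∂μ = 0)
    (hξ : ∀ n i n' j, (n, i) ≠ (n', j) → ∫ s, inner ℝ (ξ n i s) (ξ n' j s) ∂μ = 0)
    (hv : ∀ n i, ∫ s, ‖ξ n i s‖ ^ 2 ∂μ ≤ v n)
    (hdis : ∑ n, p n * ‖g n‖ ^ 2 ≤ ζ₁ * ‖∑ n, p n • g n‖ ^ 2 + ζ₂)
    (hstep : 4 * (ζ₁ * (β ^ 2 * η ^ 2 * ((m : ℝ) * ((m : ℝ) - 1)))) ≤ 1) :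
    ‖∑ n, p n • g n‖ ^ 2
        - 2 * ∫ s, inner ℝ (∑ n, p n • g n)
          (∑ n, (p n / e n) • ∑ i ∈ Finset.range (e n), (U n i s + ξ n i s)) ∂μ
        + x * ∫ s, ‖∑ n, (p n / e n) • ∑ i ∈ Finset.range (e n), (U n i s + ξ n i s)‖ ^ 2 ∂μ
      ≤ 4 * (β ^ 2 * η ^ 2 * ∑ n, p n * ((e n : ℝ) - 1) * v n)
        + 8 * (ζ₂ * (β ^ 2 * η ^ 2 * ((m : ℝ) * ((m : ℝ) - 1))))
        + 2 * x * ∑ n, p n ^ 2 / e n * v n := by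
  let L := squareIntegrableToLp (E := E) μ
  let W' : ι → ℕ → squareIntegrable (E := E) μ := fun n i => ⟨W n i, hWm n i⟩
  let U' : ι → ℕ → squareIntegrable (E := E) μ := fun n i => ⟨U n i, hUm n i⟩
  let ξ' : ι → ℕ → squareIntegrable (E := E) μ := fun n i => ⟨ξ n i, hξm n i⟩
  let κ : E →ₗ[ℝ] Lp E 2 μ := L ∘ₗ constSquareIntegrable μ
  have hnormκ : ∀ c : E, ‖κ c‖ ^ 2 = ‖c‖ ^ 2 := fun c => by
    refine (norm_sq_squareIntegrableToLp (constSquareIntegrable μ c)).trans ?_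
    simp [constSquareIntegrable]
  have hA : ∑ n, p n • κ (g n) = κ (∑ n, p n • g n) := by simp [map_sum]
  let Z : squareIntegrable (E := E) μ :=
    ∑ n, (p n / e n) • ∑ i ∈ Finset.range (e n), (U' n i + ξ' n i)
  have hZ : ∑ n, (p n / e n) • ∑ i ∈ Finset.range (e n), (L (U' n i) + L (ξ' n i)) = L Z := by
    simp [Z, map_sum]
  have hZs : ∀ s, Z.1 s = ∑ n, (p n / e n) • ∑ i ∈ Finset.range (e n), (U n i s + ξ n i s) := by
    intro s
    simp [Z, U', ξ']
  -- The subspace of deterministic vectors consists of the constants; it is finite-dimensional, so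
  -- the projection exists, and it is the expectation.
  have key := round_energy (LinearMap.range κ) hζ₁ hζ₂ hx0 hx p hp hp1 e he hem
    (η := η) (β := β) (m := m)
    (fun n i => L (W' n i)) (fun n i => L (U' n i)) (fun n i => L (ξ' n i)) (fun n => κ (g n)) v
    (fun n i => by
      rw [← map_add, ← map_smul, ← map_sub]
      congr 1
      exact Subtype.ext (funext fun s => hW n i s))
    (fun n i => by
      refine le_of_sq_le_sq ?_ (mul_nonneg hβ (norm_nonneg _))
      change ‖L (U' n i) - L (constSquareIntegrable μ (g n))‖ ^ 2 ≤ _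
      rw [mul_pow, ← map_sub, ← map_sub, norm_sq_squareIntegrableToLp,
        norm_sq_squareIntegrableToLp, ← integral_const_mul]
      refine integral_mono ((U' n i - constSquareIntegrable μ (g n)).2.integrable_norm_pow two_ne_zero)
        (((W' n i - W' n 0).2.integrable_norm_pow two_ne_zero).const_mul _) fun s => ?_
      change ‖U n i s - g n‖ ^ 2 ≤ β ^ 2 * ‖W n i s - W n 0 s‖ ^ 2
      rw [← mul_pow]
      exact pow_le_pow_left₀ (norm_nonneg _) (hU n i s) 2)
    (fun n => LinearMap.mem_range_self κ _)
    (by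
      rintro n i _ ⟨c, rfl⟩
      exact (inner_squareIntegrableToLp (constSquareIntegrable μ c) (ξ' n i)).trans (hξ0 n i c))
    (fun n i n' j h => (inner_squareIntegrableToLp (ξ' n i) (ξ' n' j)).trans (hξ n i n' j h))
    (fun n i => (norm_sq_squareIntegrableToLp (ξ' n i)).trans_le (hv n i))
    (by rw [hA, hnormκ]; simpa only [hnormκ] using hdis) hstep
  rw [hA, hZ, hnormκ, norm_sq_squareIntegrableToLp] at key
  have hin : inner ℝ (κ (∑ n, p n • g n)) (L Z) = _ :=
    inner_squareIntegrableToLp (constSquareIntegrable μ (∑ n, p n • g n)) Z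
  rw [hin] at key
  simp only [hZs] at key
  exact key

end SquareIntegrable

/-! ### Descent inequality and gradients of weighted sums. -/

section Gradient

variable {E : Type*} [NormedAddCommGroup E] [InnerProductSpace ℝ E] [CompleteSpace E]

/-- The quadratic upper bound for a function with Lipschitz gradient. -/
lemma le_quadratic_of_lipschitz_gradient {F : E → ℝ} {β : ℝ} (hF : Differentiable ℝ F)
    (hL : ∀ w w', ‖gradient F w - gradient F w'‖ ≤ β * ‖w - w'‖) (w y : E) :
    F (w + y) ≤ F w + inner ℝ (gradient F w) y + β / 2 * ‖y‖ ^ 2 := by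
  let φ : ℝ → ℝ := fun t => F (w + t • y) - t * inner ℝ (gradient F w) y - t ^ 2 * (β / 2 * ‖y‖ ^ 2)
  have hφ : ∀ t, HasDerivAt φ (inner ℝ (gradient F (w + t • y)) y - inner ℝ (gradient F w) y
      - 2 * t * (β / 2 * ‖y‖ ^ 2)) t := by
    intro t
    have h1 : HasDerivAt (fun t : ℝ => w + t • y) y t := by
      simpa using ((hasDerivAt_id t).smul_const y).const_add w
    have h2 : HasDerivAt (fun t : ℝ => F (w + t • y)) (inner ℝ (gradient F (w + t • y)) y) t := by
      exact (hF (w + t • y)).hasGradientAt.hasFDerivAt.comp_hasDerivAt t h1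
    have h3 := (hasDerivAt_id t).mul_const (inner ℝ (gradient F w) y)
    have h4 := (hasDerivAt_pow 2 t).mul_const (β / 2 * ‖y‖ ^ 2)
    refine HasDerivAt.congr_deriv (f := φ) ((h2.sub h3).sub h4) ?_
    norm_num
  have hanti : AntitoneOn φ (Set.Icc 0 1) := by
    refine antitoneOn_of_deriv_nonpos (convex_Icc 0 1)
      (fun t _ => (hφ t).continuousAt.continuousWithinAt)
      (fun t _ => (hφ t).differentiableAt.differentiableWithinAt) fun t ht => ?_
    rw [interior_Icc] at ht
    rw [(hφ t).deriv, ← inner_sub_left]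
    have h1 := hL (w + t • y) w
    rw [add_sub_cancel_left, norm_smul, Real.norm_eq_abs, abs_of_pos ht.1] at h1
    have h2 := real_inner_le_norm (gradient F (w + t • y) - gradient F w) y
    have h3 := mul_le_mul_of_nonneg_right h1 (norm_nonneg y)
    nlinarith
  have h := hanti (Set.left_mem_Icc.2 zero_le_one) (Set.right_mem_Icc.2 zero_le_one) zero_le_one
  simp only [φ, one_smul, zero_smul, add_zero, one_mul, one_pow, zero_mul, sub_zero, ne_eq,
    OfNat.ofNat_ne_zero, not_false_eq_true, zero_pow] at h
  linarith

lemma gradient_const_mul_sum {ι : Type*} (s : Finset ι) (c : ℝ) (a : ι → ℝ) (f : ι → E → ℝ)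
    {w : E} (hf : ∀ i ∈ s, DifferentiableAt ℝ (f i) w) :
    gradient (fun v => c * ∑ i ∈ s, a i * f i v) w = c • ∑ i ∈ s, a i • gradient (f i) w := by
  refine HasGradientAt.gradient ?_
  rw [hasGradientAt_iff_hasFDerivAt]
  have h := (HasFDerivAt.fun_sum fun i hi =>
    ((hf i hi).hasGradientAt.hasFDerivAt.const_mul (a i))).const_mul c
  refine h.congr_fderiv ?_
  ext y
  simp [map_sum]

end Gradient

instance {X : Type*} (S : Finset X) (b : ℕ) : Finite (Batch S b) :=
  inferInstanceAs (Finite {A : Finset X // A ∈ S.powersetCard b})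

instance {X : Type*} (S : Finset X) (b : ℕ) : DiscreteMeasurableSpace (Batch S b) :=
  ⟨fun _ => trivial⟩

/-! ### Which mini-batches each quantity depends on, and the algorithm as noisy gradient descent. -/

namespace PSL

variable {N M p : ℕ} {X : Type*} [DecidableEq X] (P : PSL N M p X)

/-- One realization of all mini-batches, as a family over the index set `BatchIdx`. -/
abbrev BatchTuple : Type _ := ∀ j : P.BatchIdx, Batch j.2.2.2.1 (P.B j.1 j.2.1 j.2.2.2.1)

/-- The mini-batches of a family over `BatchIdx`. -/
def ofTuple (x : P.BatchTuple) : P.Batches := fun k n i S => x ⟨k, n, i, S⟩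

/-- The mini-batch with index `j`. -/
def batchAt {𝓢 : Type*} (b : 𝓢 → P.Batches) (j : P.BatchIdx) (s : 𝓢) :
    Batch j.2.2.2.1 (P.B j.1 j.2.1 j.2.2.2.1) := b s j.1 j.2.1 j.2.2.1 j.2.2.2

open Classical in
/-- The indices of the mini-batches of the local iterations before `E` in the rounds before `K`
that satisfy `q`. -/
noncomputable def idx (K E : ℕ) (q : ℕ → Fin N → ℕ → Prop) : Finset P.BatchIdx :=
  ((Finset.range K).sigma fun _ => Finset.univ.sigma fun _ => Finset.range E ×ˢ Finset.univ).filter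
    fun j => q j.1 j.2.1 j.2.2.1

lemma mem_idx {K E : ℕ} {q : ℕ → Fin N → ℕ → Prop} {j : P.BatchIdx} :
    j ∈ P.idx K E q ↔ (j.1 < K ∧ j.2.2.1 < E) ∧ q j.1 j.2.1 j.2.2.1 := by
  simp [idx]

lemma dependsOn_idx {β : Type*} {K E : ℕ} {q : ℕ → Fin N → ℕ → Prop} {Z : P.Batches → β}
    (h : ∀ b b' : P.Batches, (∀ k n i, k < K → i < E → q k n i → b k n i = b' k n i) → Z b = Z b') :
    DependsOn (fun x => Z (P.ofTuple x)) (P.idx K E q : Set P.BatchIdx) := by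
  intro x y hxy
  refine h _ _ fun k n i hk hi hq => funext fun S => ?_
  exact hxy ⟨k, n, i, S⟩ (Finset.mem_coe.2 (P.mem_idx.2 ⟨⟨hk, hi⟩, hq⟩))

lemma localModel_congr {b b' : P.Batches} {k : ℕ} {n : Fin N} {w : EuclideanSpace ℝ (Fin M)}
    {i : ℕ} (h : ∀ l < i, b k n l = b' k n l) :
    P.localModel b k n w i = P.localModel b' k n w i := by
  induction i with
  | zero => rfl
  | succ i ih =>
    rw [localModel, localModel, ih fun l hl => h l (hl.trans i.lt_succ_self), h i i.lt_succ_self]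

lemma aggGrad_congr {b b' : P.Batches} {k : ℕ} {w : EuclideanSpace ℝ (Fin M)}
    (h : ∀ n, ∀ l < P.e k n, b k n l = b' k n l) : P.aggGrad b k w = P.aggGrad b' k w := by
  unfold aggGrad accGrad
  congr 1
  exact Finset.sum_congr rfl fun n _ => by rw [P.localModel_congr (h n)]

lemma model_congr {b b' : P.Batches} {K : ℕ}
    (h : ∀ k < K, ∀ n, ∀ l < P.e k n, b k n l = b' k n l) : P.model b K = P.model b' K := by
  induction K with
  | zero => rfl
  | succ K ih =>
    rw [model, model, ih fun k hk => h k (hk.trans K.lt_succ_self),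
      P.aggGrad_congr (h K K.lt_succ_self)]

/-- The error of the stochastic gradient in a local iteration at `w`. -/
noncomputable def gradNoise (b : P.Batches) (k : ℕ) (n : Fin N) (i : ℕ)
    (w : EuclideanSpace ℝ (Fin M)) : EuclideanSpace ℝ (Fin M) :=
  (1 / P.Dn k n) • ∑ S : (P.strata k n).parts,
    sampleError S.1 (P.B k n S.1) (fun d => gradient (fun v => P.f v d) w) (b k n i S).1

lemma gradNoise_congr {b b' : P.Batches} {k : ℕ} {n : Fin N} {i : ℕ}
    (h : b k n i = b' k n i) (w : EuclideanSpace ℝ (Fin M)) :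
    P.gradNoise b k n i w = P.gradNoise b' k n i w := by
  rw [gradNoise, gradNoise, h]

lemma Dn_pos (k : ℕ) (n : Fin N) : 0 < P.Dn k n := by
  unfold Dn
  exact_mod_cast (P.Dhat_nonempty k n).card_pos

lemma D_pos [NeZero N] (k : ℕ) : 0 < P.D k :=
  Finset.sum_pos (fun n _ => P.Dn_pos k n) Finset.univ_nonempty

lemma sum_Dn_div_D [NeZero N] (k : ℕ) : ∑ n, P.Dn k n / P.D k = 1 := by
  rw [← Finset.sum_div]
  exact div_self (P.D_pos k).ne'

lemma eAvg_pos [NeZero N] (k : ℕ) : 0 < P.eAvg k := by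
  refine Finset.sum_pos (fun n _ => ?_) Finset.univ_nonempty
  have := P.Dn_pos k n
  have := P.D_pos k
  have : (0 : ℝ) < P.e k n := by exact_mod_cast P.e_pos k n
  positivity

lemma Gam_pos [NeZero N] (k : ℕ) : 0 < P.Gam k :=
  mul_pos (half_pos (P.η_pos k)) (P.eAvg_pos k)

lemma e_le_eMax (k : ℕ) (n : Fin N) : P.e k n ≤ P.eMax k := Finset.le_sup (Finset.mem_univ n)

lemma sum_strata {E : Type*} [AddCommMonoid E] (k : ℕ) (n : Fin N) (g : X → E) :
    ∑ S : (P.strata k n).parts, ∑ d ∈ S.1, g d = ∑ d ∈ P.Dhat k n, g d := by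
  rw [Finset.sum_coe_sort (P.strata k n).parts fun S => ∑ d ∈ S, g d]
  conv_rhs => rw [← (P.strata k n).biUnion_parts]
  exact (Finset.sum_biUnion (P.strata k n).disjoint).symm

lemma gradient_localF (hdiff : ∀ k n, ∀ d ∈ P.Dhat k n, Differentiable ℝ (fun w => P.f w d))
    (k : ℕ) (n : Fin N) (w : EuclideanSpace ℝ (Fin M)) :
    gradient (P.localF k n) w =
      (1 / P.Dn k n) • ∑ d ∈ P.Dhat k n, gradient (fun v => P.f v d) w := by
  have h : P.localF k n = fun v => 1 / P.Dn k n * ∑ d ∈ P.Dhat k n, 1 * P.f v d := by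
    funext v
    simp [localF, localLoss, Dn, div_eq_inv_mul]
  rw [h, gradient_const_mul_sum _ _ (fun _ => 1) (fun d v => P.f v d) fun d hd => hdiff k n d hd w]
  simp

lemma differentiable_localF (hdiff : ∀ k n, ∀ d ∈ P.Dhat k n, Differentiable ℝ (fun w => P.f w d))
    (k : ℕ) (n : Fin N) : Differentiable ℝ (P.localF k n) := by
  change Differentiable ℝ fun w => (∑ d ∈ P.Dhat k n, P.f w d) / ((P.Dhat k n).card : ℝ)
  simp only [div_eq_mul_inv]
  exact (Differentiable.fun_sum fun d hd => hdiff k n d hd).mul_const _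

lemma F_eq (k : ℕ) : P.F k = fun w => 1 * ∑ n, P.Dn k n / P.D k * P.localF k n w := by
  funext w
  simp only [F, globalLoss, one_mul, Finset.mul_sum]
  exact Finset.sum_congr rfl fun n _ => by simp only [Dn, D, localF]; ring

lemma differentiable_F (hdiff : ∀ k n, ∀ d ∈ P.Dhat k n, Differentiable ℝ (fun w => P.f w d))
    (k : ℕ) : Differentiable ℝ (P.F k) := by
  rw [F_eq]
  exact (Differentiable.fun_sum fun n _ =>
    (P.differentiable_localF hdiff k n).const_mul _).const_mul _

lemma gradient_F (hdiff : ∀ k n, ∀ d ∈ P.Dhat k n, Differentiable ℝ (fun w => P.f w d))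
    (k : ℕ) (w : EuclideanSpace ℝ (Fin M)) :
    gradient (P.F k) w = ∑ n, (P.Dn k n / P.D k) • gradient (P.localF k n) w := by
  rw [F_eq, gradient_const_mul_sum _ _ _ _ fun n _ => P.differentiable_localF hdiff k n w, one_smul]

lemma gradient_F_lipschitz [NeZero N]
    (hdiff : ∀ k n, ∀ d ∈ P.Dhat k n, Differentiable ℝ (fun w => P.f w d))
    {β : ℝ} (hsmooth : P.Smooth β) (k : ℕ) (w w' : EuclideanSpace ℝ (Fin M)) :
    ‖gradient (P.F k) w - gradient (P.F k) w'‖ ≤ β * ‖w - w'‖ := by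
  have hp : ∀ n, 0 ≤ P.Dn k n / P.D k := fun n => div_nonneg (P.Dn_pos k n).le (P.D_pos k).le
  rw [P.gradient_F hdiff, P.gradient_F hdiff, ← Finset.sum_sub_distrib]
  calc ‖∑ n, ((P.Dn k n / P.D k) • gradient (P.localF k n) w
          - (P.Dn k n / P.D k) • gradient (P.localF k n) w')‖
      ≤ ∑ n, P.Dn k n / P.D k * (β * ‖w - w'‖) := by
        refine norm_sum_le_of_le _ fun n _ => ?_
        rw [← smul_sub, norm_smul, Real.norm_of_nonneg (hp n)]
        exact mul_le_mul_of_nonneg_left (hsmooth k n w w') (hp n)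
    _ = β * ‖w - w'‖ := by rw [← Finset.sum_mul, P.sum_Dn_div_D, one_mul]

/-- The strata partition the dataset, so the full sums subtracted in the sampling errors add up to
the local gradient: the update is gradient descent with additive noise. -/
lemma localModel_succ (hdiff : ∀ k n, ∀ d ∈ P.Dhat k n, Differentiable ℝ (fun w => P.f w d))
    (b : P.Batches) (k : ℕ) (n : Fin N) (w : EuclideanSpace ℝ (Fin M)) (i : ℕ) :
    P.localModel b k n w (i + 1) = P.localModel b k n w i - P.η k •
      (gradient (P.localF k n) (P.localModel b k n w i)
        + P.gradNoise b k n i (P.localModel b k n w i)) := by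
  rw [localModel, P.gradient_localF hdiff, gradNoise, ← smul_add, smul_smul, mul_one_div]
  congr 2
  simp only [sampleError, Finset.sum_sub_distrib]
  rw [P.sum_strata k n fun d => gradient (fun v => P.f v d) (P.localModel b k n w i),
    add_sub_cancel]
  simp only [Finset.smul_sum]

lemma eta_smul_aggGrad (hdiff : ∀ k n, ∀ d ∈ P.Dhat k n, Differentiable ℝ (fun w => P.f w d))
    (b : P.Batches) (k : ℕ) (w : EuclideanSpace ℝ (Fin M)) :
    P.η k • P.aggGrad b k w = (P.η k * P.eAvg k) • ∑ n, (P.Dn k n / P.D k / (P.e k n : ℝ)) •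
      ∑ i ∈ Finset.range (P.e k n), (gradient (P.localF k n) (P.localModel b k n w i)
        + P.gradNoise b k n i (P.localModel b k n w i)) := by
  have hacc : ∀ n m, w - P.localModel b k n w m = P.η k • ∑ i ∈ Finset.range m,
      (gradient (P.localF k n) (P.localModel b k n w i)
        + P.gradNoise b k n i (P.localModel b k n w i)) := by
    intro n m
    induction m with
    | zero => simp [localModel]
    | succ m ih =>
      rw [P.localModel_succ hdiff, Finset.sum_range_succ, smul_add (P.η k) (∑ i ∈ _, _),
        ← ih]
      abel
  rw [aggGrad, smul_smul]
  congr 1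
  refine Finset.sum_congr rfl fun n _ => ?_
  rw [accGrad, hacc, smul_smul (1 / P.η k), one_div_mul_cancel (P.η_pos k).ne', one_smul, div_div]

lemma noise_eq (k : ℕ) (n : Fin N) : P.noise k n = (1 / P.Dn k n) ^ 2 *
    ∑ S : (P.strata k n).parts, ((S.1.card : ℝ) - P.B k n S.1) / P.B k n S.1 *
      ∑ d ∈ S.1, ‖P.feat d - P.stratumMean S.1‖ ^ 2 := by
  rw [noise, ← Finset.sum_coe_sort, Finset.mul_sum]
  refine Finset.sum_congr rfl fun S _ => ?_
  have hB := P.B_pos k n S.1 S.2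
  have hBS := P.B_le k n S.1 S.2
  have hB0 : (P.B k n S.1 : ℝ) ≠ 0 := by exact_mod_cast (by omega : P.B k n S.1 ≠ 0)
  have hS0 : (S.1.card : ℝ) ≠ 0 := by exact_mod_cast (by omega : S.1.card ≠ 0)
  have hD := (P.Dn_pos k n).ne'
  -- In a singleton stratum the batch is everything and both sides vanish, whatever the sample
  -- deviation is there.
  rcases (show 1 ≤ S.1.card by omega).eq_or_lt with h1 | h2
  · have hB1 : P.B k n S.1 = 1 := by omega
    rw [hB1, ← h1]; simp
  · have h3 : (0 : ℝ) < (S.1.card : ℝ) - 1 := by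
      have : (1 : ℝ) < S.1.card := by exact_mod_cast h2
      linarith
    rw [stratumStd, Real.sq_sqrt (mul_nonneg (one_div_nonneg.2 h3.le)
      (Finset.sum_nonneg fun _ _ => sq_nonneg _))]
    have := h3.ne'
    field_simp

end PSL

/-! ### Moments of the gradient noise at a fixed model. -/

namespace PSL

variable {N M p : ℕ} {X : Type*} [DecidableEq X] {P : PSL N M p X}
  {𝓢 : Type*} [MeasurableSpace 𝓢] {μ : Measure 𝓢} [IsProbabilityMeasure μ] {b : 𝓢 → P.Batches}

omit [IsProbabilityMeasure μ] in
lemma StratifiedSampling.measurable_batchAt (hb : P.StratifiedSampling μ b) (j : P.BatchIdx) :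
    Measurable (P.batchAt b j) := hb.measurable _ _ _ _

lemma StratifiedSampling.integrable (hb : P.StratifiedSampling μ b) {E : Type*}
    [NormedAddCommGroup E] {J : Finset P.BatchIdx} {Z : P.Batches → E}
    (hZ : DependsOn (fun x => Z (P.ofTuple x)) (J : Set P.BatchIdx)) :
    Integrable (fun s => Z (b s)) μ :=
  integrable_of_dependsOn (Y := P.batchAt b) hb.measurable_batchAt hZ

lemma StratifiedSampling.memLp_two (hb : P.StratifiedSampling μ b) {E : Type*}
    [NormedAddCommGroup E] {J : Finset P.BatchIdx} {Z : P.Batches → E}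
    (hZ : DependsOn (fun x => Z (P.ofTuple x)) (J : Set P.BatchIdx)) :
    MemLp (fun s => Z (b s)) 2 μ :=
  (memLp_two_iff_integrable_sq_norm (hb.integrable hZ).aestronglyMeasurable).2
    (hb.integrable (Z := fun c => ‖Z c‖ ^ 2) fun x y h => by
      have := hZ h
      simp only at this ⊢
      rw [this])

lemma StratifiedSampling.integral_integral (hb : P.StratifiedSampling μ b)
    {S T : Finset P.BatchIdx} (hST : Disjoint S T) {V : Type*} {Z : P.Batches → V}
    (hZ : DependsOn (fun x => Z (P.ofTuple x)) (S : Set P.BatchIdx))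
    {F : V → P.Batches → ℝ}
    (hF : ∀ v, DependsOn (fun x => F v (P.ofTuple x)) (T : Set P.BatchIdx)) :
    ∫ s, F (Z (b s)) (b s) ∂μ = ∫ s, ∫ s', F (Z (b s)) (b s') ∂μ ∂μ :=
  integral_dependsOn_eq_integral_integral (Y := P.batchAt b) hb.measurable_batchAt hb.indep hST
    (F := fun v x => F v (P.ofTuple x)) hZ hF

lemma StratifiedSampling.integral_batch (hb : P.StratifiedSampling μ b) {E : Type*}
    [NormedAddCommGroup E] [NormedSpace ℝ E] [CompleteSpace E] (k : ℕ) (n : Fin N) (i : ℕ)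
    (S : (P.strata k n).parts) (φ : Finset X → E) :
    ∫ s, φ (b s k n i S).1 ∂μ = (1 / (S.1.card.choose (P.B k n S.1) : ℝ)) •
      ∑ A ∈ S.1.powersetCard (P.B k n S.1), φ A := by
  have hm := hb.measurable k n i S
  have := Measure.isProbabilityMeasure_map (μ := μ) hm.aemeasurable
  let _ : Fintype (Batch S.1 (P.B k n S.1)) := Finset.fintypeCoeSort _
  calc ∫ s, φ (b s k n i S).1 ∂μ
      = ∫ A : Batch S.1 (P.B k n S.1), φ A.1 ∂(μ.map fun s => b s k n i S) :=
        (integral_map (f := fun A : Batch S.1 (P.B k n S.1) => φ A.1)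
          hm.aemeasurable .of_discrete).symm
    _ = ∑ A : Batch S.1 (P.B k n S.1), (1 / (S.1.card.choose (P.B k n S.1) : ℝ)) • φ A.1 := by
        rw [integral_fintype Integrable.of_finite]
        refine Finset.sum_congr rfl fun A _ => ?_
        rw [map_measureReal_apply hm (MeasurableSet.singleton A)]
        congr 1
        exact hb.uniform k n i S A
    _ = _ := by
        rw [← Finset.smul_sum]
        congr 1
        exact Finset.sum_coe_sort (S.1.powersetCard (P.B k n S.1)) φ

lemma dependsOn_gradNoise (k : ℕ) (n : Fin N) (i : ℕ) (w : EuclideanSpace ℝ (Fin M)) :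
    DependsOn (fun x => P.gradNoise (P.ofTuple x) k n i w)
      (P.idx (k + 1) (i + 1) (fun k' n' i' => k' = k ∧ n' = n ∧ i' = i) : Set P.BatchIdx) :=
  P.dependsOn_idx (Z := fun c => P.gradNoise c k n i w) fun _ _ h =>
    P.gradNoise_congr (h k n i k.lt_succ_self i.lt_succ_self ⟨rfl, rfl, rfl⟩) w

lemma StratifiedSampling.integrable_batch (hb : P.StratifiedSampling μ b) {E : Type*}
    [NormedAddCommGroup E] (k : ℕ) (n : Fin N) (i : ℕ) (S : (P.strata k n).parts)
    (φ : Finset X → E) : Integrable (fun s => φ (b s k n i S).1) μ :=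
  hb.integrable (Z := fun c => φ (c k n i S).1) (J := {⟨k, n, i, S⟩}) fun x y h => by
    have := h ⟨k, n, i, S⟩ (by simp)
    simp only [ofTuple, this]

lemma StratifiedSampling.integral_sampleError (hb : P.StratifiedSampling μ b) {E : Type*}
    [NormedAddCommGroup E] [InnerProductSpace ℝ E] [CompleteSpace E] (k : ℕ) (n : Fin N) (i : ℕ)
    (S : (P.strata k n).parts) (u : X → E) :
    ∫ s, sampleError S.1 (P.B k n S.1) u (b s k n i S).1 ∂μ = 0 := by
  rw [hb.integral_batch k n i S (sampleError S.1 (P.B k n S.1) u),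
    sum_sampleError _ (P.B_pos k n S.1 S.2), smul_zero]

lemma StratifiedSampling.integral_gradNoise (hb : P.StratifiedSampling μ b) (k : ℕ) (n : Fin N)
    (i : ℕ) (w : EuclideanSpace ℝ (Fin M)) : ∫ s, P.gradNoise (b s) k n i w ∂μ = 0 := by
  unfold gradNoise
  rw [integral_smul, integral_finsetSum _ fun S _ => hb.integrable_batch k n i S _,
    Finset.sum_eq_zero fun S _ => hb.integral_sampleError k n i S _, smul_zero]

lemma StratifiedSampling.integral_inner_gradNoise (hb : P.StratifiedSampling μ b) (k : ℕ)
    (n : Fin N) (i : ℕ) (w z : EuclideanSpace ℝ (Fin M)) :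
    ∫ s, inner ℝ z (P.gradNoise (b s) k n i w) ∂μ = 0 := by
  refine (integral_inner (hb.integrable (Z := fun c => P.gradNoise c k n i w)
    (dependsOn_gradNoise k n i w)) z).trans ?_
  rw [hb.integral_gradNoise, inner_zero_right]

lemma StratifiedSampling.integral_inner_sampleError (hb : P.StratifiedSampling μ b) {E : Type*}
    [NormedAddCommGroup E] [InnerProductSpace ℝ E] [CompleteSpace E] (k : ℕ) (n : Fin N) (i : ℕ)
    {S T : (P.strata k n).parts} (hST : S ≠ T) (u : X → E) :
    ∫ s, inner ℝ (sampleError S.1 (P.B k n S.1) u (b s k n i S).1)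
      (sampleError T.1 (P.B k n T.1) u (b s k n i T).1) ∂μ = 0 := by
  have h := hb.integral_integral (S := {⟨k, n, i, S⟩}) (T := {⟨k, n, i, T⟩})
    (by simpa using hST)
    (Z := fun c => sampleError S.1 (P.B k n S.1) u (c k n i S).1)
    (F := fun v c => inner ℝ v (sampleError T.1 (P.B k n T.1) u (c k n i T).1))
    (fun x y h => by
      have := h ⟨k, n, i, S⟩ (by simp)
      simp only [ofTuple, this])
    (fun v x y h => by
      have := h ⟨k, n, i, T⟩ (by simp)
      simp only [ofTuple, this])
  rw [h]
  refine (integral_congr_ae (.of_forall fun s => ?_)).trans (integral_zero _ _)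
  exact (integral_inner (hb.integrable_batch k n i T _) _).trans
    (by rw [hb.integral_sampleError, inner_zero_right])

/-- Errors of different strata are independent and centred, so cross terms vanish and the strata
contribute their variances separately. -/
lemma StratifiedSampling.integral_gradNoise_sq_le (hb : P.StratifiedSampling μ b) {Θ : Fin N → ℝ}
    (hΘ : P.DataVariability Θ) (k : ℕ) (n : Fin N) (i : ℕ) (w : EuclideanSpace ℝ (Fin M)) :
    ∫ s, ‖P.gradNoise (b s) k n i w‖ ^ 2 ∂μ ≤ 2 * Θ n ^ 2 * P.noise k n := by
  set u : X → EuclideanSpace ℝ (Fin M) := fun d => gradient (fun v => P.f v d) w with hu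
  let ε : (P.strata k n).parts → 𝓢 → EuclideanSpace ℝ (Fin M) := fun S s =>
    sampleError S.1 (P.B k n S.1) u (b s k n i S).1
  have hsq : ∀ s, ‖P.gradNoise (b s) k n i w‖ ^ 2 =
      (1 / P.Dn k n) ^ 2 * ∑ S, ∑ T, inner ℝ (ε S s) (ε T s) := by
    intro s
    rw [gradNoise, norm_smul, mul_pow, Real.norm_eq_abs, sq_abs, ← real_inner_self_eq_norm_sq,
      sum_inner]
    simp only [inner_sum]
    rfl
  have hint : ∀ S T, Integrable (fun s => inner ℝ (ε S s) (ε T s)) μ := fun S T =>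
    hb.integrable (J := {⟨k, n, i, S⟩, ⟨k, n, i, T⟩})
      (Z := fun c => inner ℝ (sampleError S.1 (P.B k n S.1) u (c k n i S).1)
        (sampleError T.1 (P.B k n T.1) u (c k n i T).1)) fun x y h => by
      have h1 := h ⟨k, n, i, S⟩ (by simp)
      have h2 := h ⟨k, n, i, T⟩ (by simp)
      simp only [ofTuple, h1, h2]
  have hdiag : ∀ S, ∑ T, ∫ s, inner ℝ (ε S s) (ε T s) ∂μ = ∫ s, ‖ε S s‖ ^ 2 ∂μ := by
    intro S
    rw [Finset.sum_eq_single S]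
    · simp_rw [real_inner_self_eq_norm_sq]
    · exact fun T _ hT => hb.integral_inner_sampleError k n i hT.symm u
    · simp
  simp_rw [hsq]
  rw [integral_const_mul, integral_finsetSum _ fun S _ => integrable_finsetSum _ fun T _ => hint S T]
  simp_rw [integral_finsetSum _ fun T _ => hint _ T, hdiag]
  conv_rhs => rw [P.noise_eq, mul_left_comm, Finset.mul_sum]
  refine mul_le_mul_of_nonneg_left (Finset.sum_le_sum fun S _ => ?_) (sq_nonneg _)
  have hB := P.B_pos k n S.1 S.2
  have hBS := P.B_le k n S.1 S.2
  have hC : (0 : ℝ) < S.1.card.choose (P.B k n S.1) := by exact_mod_cast Nat.choose_pos hBS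
  have hsub : S.1 ⊆ P.Dhat k n := (P.strata k n).le S.2
  rw [hb.integral_batch k n i S fun A => ‖sampleError S.1 (P.B k n S.1) u A‖ ^ 2, smul_eq_mul,
    one_div_mul_eq_div, div_le_iff₀ hC, mul_comm]
  exact sum_sampleError_sq_le S.1 hB hBS u P.feat fun d hd d' hd' =>
    hΘ k n w d (hsub hd) d' (hsub hd')

end PSL

/-! ### Noise along the local trajectories and the descent of one round. -/

namespace PSL

variable {N M p : ℕ} {X : Type*} [DecidableEq X] {P : PSL N M p X}

lemma dependsOn_localModel (k : ℕ) (n : Fin N) (w : EuclideanSpace ℝ (Fin M)) (i : ℕ)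
    {K E : ℕ} {q : ℕ → Fin N → ℕ → Prop} (hK : k < K) (hE : i ≤ E) (hq : ∀ l < i, q k n l) :
    DependsOn (fun x => P.localModel (P.ofTuple x) k n w i) (P.idx K E q : Set P.BatchIdx) :=
  P.dependsOn_idx (Z := fun c => P.localModel c k n w i) fun _ _ h =>
    P.localModel_congr fun l hl => h k n l hK (hl.trans_le hE) (hq l hl)

lemma dependsOn_gradNoise_localModel (k : ℕ) (n : Fin N) (w : EuclideanSpace ℝ (Fin M)) (i : ℕ)
    {K E : ℕ} {q : ℕ → Fin N → ℕ → Prop} (hK : k < K) (hE : i < E) (hq : ∀ l ≤ i, q k n l) :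
    DependsOn (fun x => P.gradNoise (P.ofTuple x) k n i (P.localModel (P.ofTuple x) k n w i))
      (P.idx K E q : Set P.BatchIdx) :=
  P.dependsOn_idx (Z := fun c => P.gradNoise c k n i (P.localModel c k n w i)) fun c c' h => by
    have h1 : P.localModel c k n w i = P.localModel c' k n w i :=
      P.localModel_congr fun l hl => h k n l hK (hl.trans hE) (hq l hl.le)
    simp only [h1]
    exact P.gradNoise_congr (h k n i hK hE (hq i le_rfl)) _

lemma dependsOn_aggGrad (k : ℕ) (w : EuclideanSpace ℝ (Fin M)) {K E : ℕ}
    {q : ℕ → Fin N → ℕ → Prop} (hK : k < K) (hE : P.eMax k ≤ E) (hq : ∀ n l, q k n l) :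
    DependsOn (fun x => P.aggGrad (P.ofTuple x) k w) (P.idx K E q : Set P.BatchIdx) :=
  P.dependsOn_idx (Z := fun c => P.aggGrad c k w) fun _ _ h =>
    P.aggGrad_congr fun n l hl => h k n l hK (hl.trans_le ((P.e_le_eMax k n).trans hE)) (hq n l)

lemma dependsOn_model (K : ℕ) : DependsOn (fun x => P.model (P.ofTuple x) K)
    (P.idx K ((Finset.range K).sup P.eMax) fun _ _ _ => True : Set P.BatchIdx) :=
  P.dependsOn_idx (Z := fun c => P.model c K) fun _ _ h =>
    P.model_congr fun k hk n l hl => h k n l hk (hl.trans_le ((P.e_le_eMax k n).trans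
      (Finset.le_sup (Finset.mem_range.2 hk)))) trivial

section Round

variable {𝓢 : Type*} [MeasurableSpace 𝓢] {μ : Measure 𝓢} [IsProbabilityMeasure μ]
  {b : 𝓢 → P.Batches}

lemma StratifiedSampling.integral_gradNoise_sq_localModel_le (hb : P.StratifiedSampling μ b)
    {Θ : Fin N → ℝ} (hΘ : P.DataVariability Θ) (k : ℕ) (n : Fin N) (i : ℕ)
    (w : EuclideanSpace ℝ (Fin M)) :
    ∫ s, ‖P.gradNoise (b s) k n i (P.localModel (b s) k n w i)‖ ^ 2 ∂μ ≤
      2 * Θ n ^ 2 * P.noise k n := by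
  have hdisj : Disjoint (P.idx (k + 1) i fun _ _ _ => True)
      (P.idx (k + 1) (i + 1) fun k' n' i' => k' = k ∧ n' = n ∧ i' = i) := by
    refine Finset.disjoint_left.2 fun j hj hj' => ?_
    have h1 := P.mem_idx.1 hj
    have h2 := P.mem_idx.1 hj'
    omega
  have hF : ∀ v, DependsOn (fun x => ‖P.gradNoise (P.ofTuple x) k n i v‖ ^ 2)
      (P.idx (k + 1) (i + 1) (fun k' n' i' => k' = k ∧ n' = n ∧ i' = i) : Set P.BatchIdx) :=
    fun v x y h => by
      have := dependsOn_gradNoise k n i v h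
      simp only at this ⊢
      rw [this]
  -- The iterate before step i uses batches below i only, so it can be frozen while batch i is
  -- averaged.
  rw [hb.integral_integral hdisj (Z := fun c => P.localModel c k n w i)
    (F := fun v c => ‖P.gradNoise c k n i v‖ ^ 2)
    (dependsOn_localModel k n w i k.lt_succ_self le_rfl fun _ _ => trivial) hF]
  refine (integral_mono_of_nonneg (.of_forall fun s => integral_nonneg fun _ => sq_nonneg _)
    (integrable_const _) (.of_forall fun s => hb.integral_gradNoise_sq_le hΘ k n i _)).trans ?_
  simp

/-- The gradient noise of a local iteration is orthogonal to everything that does not depend on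
the mini-batches of that iteration. -/
lemma StratifiedSampling.integral_inner_gradNoise_localModel (hb : P.StratifiedSampling μ b)
    (k : ℕ) (n : Fin N) (i : ℕ) (w : EuclideanSpace ℝ (Fin M)) {E : ℕ} (hE : i ≤ E)
    {Z : P.Batches → EuclideanSpace ℝ (Fin M)}
    (hZ : DependsOn (fun x => Z (P.ofTuple x))
      (P.idx (k + 1) E (fun _ n' i' => n' ≠ n ∨ i' ≠ i) : Set P.BatchIdx)) :
    ∫ s, inner ℝ (Z (b s)) (P.gradNoise (b s) k n i (P.localModel (b s) k n w i)) ∂μ = 0 := by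
  have hdisj : Disjoint (P.idx (k + 1) E fun _ n' i' => n' ≠ n ∨ i' ≠ i)
      (P.idx (k + 1) (i + 1) fun k' n' i' => k' = k ∧ n' = n ∧ i' = i) := by
    refine Finset.disjoint_left.2 fun j hj hj' => ?_
    have h1 := (P.mem_idx.1 hj).2
    have h2 := (P.mem_idx.1 hj').2
    tauto
  have hW := dependsOn_localModel (P := P) k n w i (q := fun _ n' i' => n' ≠ n ∨ i' ≠ i)
    k.lt_succ_self hE fun l hl => Or.inr hl.ne
  have hF : ∀ v : EuclideanSpace ℝ (Fin M) × EuclideanSpace ℝ (Fin M),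
      DependsOn (fun x => inner ℝ v.1 (P.gradNoise (P.ofTuple x) k n i v.2))
      (P.idx (k + 1) (i + 1) (fun k' n' i' => k' = k ∧ n' = n ∧ i' = i) : Set P.BatchIdx) :=
    fun v x y h => by
      have := dependsOn_gradNoise k n i v.2 h
      simp only at this ⊢
      rw [this]
  -- The test vector and the iterate are frozen jointly, as they may be correlated.
  rw [hb.integral_integral hdisj (Z := fun c => (Z c, P.localModel c k n w i))
    (F := fun v c => inner ℝ v.1 (P.gradNoise c k n i v.2))
    (fun x y h => Prod.ext (hZ h) (hW h)) hF]
  exact (integral_congr_ae (.of_forall fun s => hb.integral_inner_gradNoise k n i _ _)).trans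
    (integral_zero _ _)

lemma StratifiedSampling.integral_inner_gradNoise_gradNoise (hb : P.StratifiedSampling μ b)
    (k : ℕ) (w : EuclideanSpace ℝ (Fin M)) {n n' : Fin N} {i j : ℕ} (h : (n, i) ≠ (n', j)) :
    ∫ s, inner ℝ (P.gradNoise (b s) k n i (P.localModel (b s) k n w i))
      (P.gradNoise (b s) k n' j (P.localModel (b s) k n' w j)) ∂μ = 0 := by
  -- On one device, the earlier noise must be the frozen one, since the later iterate depends on it;
  -- the case j < i follows by symmetry.
  have key : ∀ (n n' : Fin N) (i j : ℕ), (n ≠ n' ∨ i < j) →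
      ∫ s, inner ℝ (P.gradNoise (b s) k n i (P.localModel (b s) k n w i))
        (P.gradNoise (b s) k n' j (P.localModel (b s) k n' w j)) ∂μ = 0 := fun n n' i j h =>
    hb.integral_inner_gradNoise_localModel k n' j w (le_max_right (i + 1) j)
      (Z := fun c => P.gradNoise c k n i (P.localModel c k n w i))
      (dependsOn_gradNoise_localModel k n w i k.lt_succ_self
        (i.lt_succ_self.trans_le (le_max_left _ _))
        fun l hl => h.imp id fun hij => (hl.trans_lt hij).ne)
  by_cases hn : n = n'
  · subst hn
    rcases lt_trichotomy i j with hij | hij | hij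
    · exact key n n i j (Or.inr hij)
    · simp [hij] at h
    · exact (integral_congr_ae (.of_forall fun s => real_inner_comm _ _)).trans
        (key n n j i (Or.inr hij))
  · exact key n n' i j (Or.inl hn)

/-- The error terms of round `k` in the convergence bound. -/
noncomputable def roundError (P : PSL N M p X) (β ζ₂ θ : ℝ) (k : ℕ) : ℝ :=
  8 * β ^ 2 * θ ^ 2 * P.η k ^ 2 * ∑ n, P.Dn k n / P.D k * ((P.e k n : ℝ) - 1) * P.noise k n
    + 8 * ζ₂ * P.η k ^ 2 * β ^ 2 * (P.eMax k : ℝ) * ((P.eMax k : ℝ) - 1)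
    + 8 * θ ^ 2 * β * P.Gam k *
      ∑ n, (P.Dn k n / (P.D k * Real.sqrt (P.e k n : ℝ))) ^ 2 * P.noise k n

lemma noise_nonneg (k : ℕ) (n : Fin N) : 0 ≤ P.noise k n := by
  rw [noise_eq]
  refine mul_nonneg (sq_nonneg _) (Finset.sum_nonneg fun S _ => mul_nonneg
    (div_nonneg ?_ (Nat.cast_nonneg _)) (Finset.sum_nonneg fun _ _ => sq_nonneg _))
  have : (P.B k n S.1 : ℝ) ≤ S.1.card := by exact_mod_cast P.B_le k n S.1 S.2
  linarith

/-- Expected decrease of the global loss in one round started at a deterministic model. -/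
lemma StratifiedSampling.gam_mul_norm_gradient_sq_le [NeZero N] (hb : P.StratifiedSampling μ b)
    (hdiff : ∀ k n, ∀ d ∈ P.Dhat k n, Differentiable ℝ (fun w => P.f w d))
    {β : ℝ} (hβ : 0 < β) (hsmooth : P.Smooth β)
    {ζ₁ ζ₂ : ℝ} (hζ₁ : 1 ≤ ζ₁) (hζ₂ : 0 ≤ ζ₂) (hdis : P.BoundedDissimilarity ζ₁ ζ₂)
    {Θ : Fin N → ℝ} (hΘ₀ : ∀ n, 0 ≤ Θ n) (hΘ : P.DataVariability Θ) {θ : ℝ} (hθ : ∀ n, Θ n ≤ θ)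
    {k : ℕ} (hη₁ : 4 * (ζ₁ * (β ^ 2 * P.η k ^ 2 * ((P.eMax k : ℝ) * ((P.eMax k : ℝ) - 1)))) ≤ 1)
    (hη₂ : β * (P.η k * P.eAvg k) ≤ 1 / 2) (w : EuclideanSpace ℝ (Fin M)) :
    P.Gam k * ‖gradient (P.F k) w‖ ^ 2 ≤
      P.F k w - ∫ s, P.F k (w - P.η k • P.aggGrad (b s) k w) ∂μ
        + P.Gam k * P.roundError β ζ₂ θ k := by
  have hη := P.η_pos k
  have he := P.eAvg_pos k
  have hD := P.D_pos k
  set h : ℝ := P.η k * P.eAvg k with hh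
  have hh0 : 0 < h := mul_pos hη he
  have hΓ : P.Gam k = h / 2 := by rw [Gam, hh]; ring
  let pr : Fin N → ℝ := fun n => P.Dn k n / P.D k
  have hpr : ∀ n, 0 ≤ pr n := fun n => div_nonneg (P.Dn_pos k n).le hD.le
  let W : Fin N → ℕ → 𝓢 → EuclideanSpace ℝ (Fin M) := fun n i s => P.localModel (b s) k n w i
  let U : Fin N → ℕ → 𝓢 → EuclideanSpace ℝ (Fin M) := fun n i s =>
    gradient (P.localF k n) (W n i s)
  let ξ : Fin N → ℕ → 𝓢 → EuclideanSpace ℝ (Fin M) := fun n i s =>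
    P.gradNoise (b s) k n i (W n i s)
  let Z : 𝓢 → EuclideanSpace ℝ (Fin M) := fun s =>
    ∑ n, (pr n / P.e k n) • ∑ i ∈ Finset.range (P.e k n), (U n i s + ξ n i s)
  have hdepW : ∀ n i, DependsOn (fun x => P.localModel (P.ofTuple x) k n w i)
      (P.idx (k + 1) i (fun _ _ _ => True) : Set P.BatchIdx) := fun n i =>
    dependsOn_localModel k n w i k.lt_succ_self le_rfl fun _ _ => trivial
  have hWm : ∀ n i, MemLp (W n i) 2 μ := fun n i =>
    hb.memLp_two (Z := fun c => P.localModel c k n w i) (hdepW n i)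
  have hUm : ∀ n i, MemLp (U n i) 2 μ := fun n i =>
    hb.memLp_two (Z := fun c => gradient (P.localF k n) (P.localModel c k n w i))
      fun x y hxy => congrArg _ (hdepW n i hxy)
  have hξm : ∀ n i, MemLp (ξ n i) 2 μ := fun n i =>
    hb.memLp_two (Z := fun c => P.gradNoise c k n i (P.localModel c k n w i))
      (dependsOn_gradNoise_localModel k n w i k.lt_succ_self i.lt_succ_self
        (q := fun _ _ _ => True) fun _ _ => trivial)
  have hZm : MemLp Z 2 μ := memLp_finsetSum _ fun n _ =>
    (show MemLp (fun s => ∑ i ∈ Finset.range (P.e k n), (U n i s + ξ n i s)) 2 μ from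
      memLp_finsetSum _ fun i _ => (hUm n i).add (hξm n i)).const_smul (pr n / P.e k n)
  have hA : gradient (P.F k) w = ∑ n, pr n • gradient (P.localF k n) w := P.gradient_F hdiff k w
  -- The choice x = βh matches the quadratic term (β/2)h²‖Z‖² after the estimate is multiplied by
  -- h/2, and `hη₂` is x ≤ 1/2.
  have key := integral_round_energy (μ := μ) (η := P.η k) (x := β * h) hβ.le hζ₁ hζ₂
    (mul_nonneg hβ.le hh0.le) hη₂ pr hpr (P.sum_Dn_div_D k) (P.e k) (P.e_pos k) (P.e_le_eMax k)
    W U ξ (fun n => gradient (P.localF k n) w) (fun n => 2 * θ ^ 2 * P.noise k n) hWm hUm hξm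
    (fun n i s => P.localModel_succ hdiff (b s) k n w i)
    (fun n i s => hsmooth k n _ _)
    (fun n i c => hb.integral_inner_gradNoise_localModel k n i w le_rfl (Z := fun _ => c)
      fun _ _ _ => rfl)
    (fun n i n' j hne => hb.integral_inner_gradNoise_gradNoise k w hne)
    (fun n i => (hb.integral_gradNoise_sq_localModel_le hΘ k n i w).trans (by
      have := noise_nonneg (P := P) k n
      have := hΘ₀ n
      have := hθ n
      gcongr))
    (hdis pr hpr (P.sum_Dn_div_D k) k w) hη₁
  rw [← hA] at key
  change _ - 2 * ∫ s, inner ℝ (gradient (P.F k) w) (Z s) ∂μ + β * h * ∫ s, ‖Z s‖ ^ 2 ∂μ ≤ _ at key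
  have hpt : ∀ s, P.F k (w - P.η k • P.aggGrad (b s) k w) ≤
      P.F k w - h * inner ℝ (gradient (P.F k) w) (Z s) + β / 2 * h ^ 2 * ‖Z s‖ ^ 2 := by
    intro s
    have hq := le_quadratic_of_lipschitz_gradient (P.differentiable_F hdiff k)
      (P.gradient_F_lipschitz hdiff hsmooth k) w (-(h • Z s))
    rw [P.eta_smul_aggGrad hdiff, sub_eq_add_neg]
    refine hq.trans (le_of_eq ?_)
    rw [inner_neg_right, real_inner_smul_right, norm_neg, norm_smul, mul_pow, Real.norm_eq_abs,
      sq_abs]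
    ring
  have hi1 : Integrable (fun s => inner ℝ (gradient (P.F k) w) (Z s)) μ :=
    (hZm.integrable (by norm_num)).const_inner _
  have hi2 : Integrable (fun s => ‖Z s‖ ^ 2) μ := hZm.integrable_norm_pow two_ne_zero
  have hi3 : Integrable (fun s => P.F k (w - P.η k • P.aggGrad (b s) k w)) μ :=
    hb.integrable (Z := fun c => P.F k (w - P.η k • P.aggGrad c k w)) fun x y hxy => by
      have := dependsOn_aggGrad (P := P) k w k.lt_succ_self le_rfl
        (q := fun _ _ _ => True) (fun _ _ => trivial) hxy
      simp only at this ⊢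
      rw [this]
  have hi4 : Integrable (fun s => P.F k w - h * inner ℝ (gradient (P.F k) w) (Z s)) μ :=
    (integrable_const (P.F k w)).sub (hi1.const_mul h)
  have hE := integral_mono hi3
    (hi4.add (hi2.const_mul (β / 2 * h ^ 2))) hpt
  have hE2 : ∫ s, (P.F k w - h * inner ℝ (gradient (P.F k) w) (Z s)
      + β / 2 * h ^ 2 * ‖Z s‖ ^ 2) ∂μ = P.F k w
      - h * ∫ s, inner ℝ (gradient (P.F k) w) (Z s) ∂μ + β / 2 * h ^ 2 * ∫ s, ‖Z s‖ ^ 2 ∂μ := by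
    rw [integral_add hi4 (hi2.const_mul _),
      integral_sub (integrable_const _) (hi1.const_mul h), integral_const_mul, integral_const_mul]
    simp
  have hE' := hE.trans_eq hE2
  -- With noise level 2θ² times `noise` and h = 2Γ, the constants 4 · 2 and 2 · 2 · 2 give the two
  -- eights of the theorem's noise terms.
  have herr : 4 * (β ^ 2 * P.η k ^ 2 *
        ∑ n, pr n * ((P.e k n : ℝ) - 1) * (2 * θ ^ 2 * P.noise k n))
      + 8 * (ζ₂ * (β ^ 2 * P.η k ^ 2 * ((P.eMax k : ℝ) * ((P.eMax k : ℝ) - 1))))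
      + 2 * (β * h) * ∑ n, pr n ^ 2 / P.e k n * (2 * θ ^ 2 * P.noise k n) =
      P.roundError β ζ₂ θ k := by
    have h1 : ∑ n, pr n * ((P.e k n : ℝ) - 1) * (2 * θ ^ 2 * P.noise k n) =
        2 * θ ^ 2 * ∑ n, P.Dn k n / P.D k * ((P.e k n : ℝ) - 1) * P.noise k n := by
      rw [Finset.mul_sum]
      exact Finset.sum_congr rfl fun n _ => by ring
    have h2 : ∑ n, pr n ^ 2 / P.e k n * (2 * θ ^ 2 * P.noise k n) =
        2 * θ ^ 2 * ∑ n, (P.Dn k n / (P.D k * Real.sqrt (P.e k n : ℝ))) ^ 2 * P.noise k n := by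
      rw [Finset.mul_sum]
      refine Finset.sum_congr rfl fun n _ => ?_
      rw [div_pow _ (P.D k * _), mul_pow, Real.sq_sqrt (Nat.cast_nonneg _), ← div_div, ← div_pow]
      ring
    rw [h1, h2, roundError, hΓ]
    ring
  rw [herr] at key
  have key' := mul_le_mul_of_nonneg_left key (half_pos hh0).le
  rw [hΓ]
  linarith

end Round

/-! ### Change of the global loss during idle periods. -/

section Drift

omit [DecidableEq X] in
-- The global loss sees only the pooled multiset of data, so moving points between devices leaves it
-- unchanged.
lemma globalLoss_eq_multiset_sum (f : EuclideanSpace ℝ (Fin M) → X → ℝ) (D : Fin N → Finset X)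
    (w : EuclideanSpace ℝ (Fin M)) :
    globalLoss f D w = 1 / ((∑ n, (D n).val).card : ℝ) * ((∑ n, (D n).val).map (f w)).sum := by
  have h1 : totalCard D = ((∑ n, (D n).val).card : ℝ) := by
    rw [Multiset.card_sum]
    simp [totalCard]
  have h2 : ((∑ n, (D n).val).map (f w)).sum = ∑ n, ∑ d ∈ D n, f w d := by
    rw [← Multiset.coe_mapAddMonoidHom, map_sum, ← Multiset.coe_sumAddMonoidHom, map_sum]
    rfl
  rw [globalLoss, h1, h2]
  congr 1
  refine Finset.sum_congr rfl fun n _ => ?_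
  rw [localLoss]
  rcases (D n).eq_empty_or_nonempty with h | h
  · simp [h]
  · exact mul_div_cancel₀ _ (by exact_mod_cast h.card_pos.ne')

lemma sum_wallLoss (t : ℝ) (w : EuclideanSpace ℝ (Fin M)) :
    ∑ n, P.wallLoss n t w = globalLoss P.f (P.data t) w := by
  rw [globalLoss, Finset.mul_sum]
  exact Finset.sum_congr rfl fun n _ => by rw [wallLoss]; ring

lemma prevF_eq (k : ℕ) : P.prevF k = globalLoss P.f (P.data (idleStart P.Ω P.T k)) := by
  cases k with
  | zero => rfl
  | succ k =>
    have : P.data (idleStart P.Ω P.T (k + 1)) = P.Dhat k := funext fun n => P.data_end k n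
    rw [this]
    rfl

lemma F_sub_prevF_le {Δ : Fin N → ℝ → ℝ} (hΔ : P.Drift Δ) (k : ℕ)
    (w : EuclideanSpace ℝ (Fin M)) :
    P.F k w - P.prevF k w ≤ (P.Ω (k + 1) : ℝ) * P.maxDrift Δ k := by
  have hF : P.F k w = globalLoss P.f (P.data (roundStart P.Ω P.T k)) w := by
    rw [F, globalLoss_eq_multiset_sum, globalLoss_eq_multiset_sum, P.dispersion]
  rw [hF, prevF_eq, ← sum_wallLoss, ← sum_wallLoss, ← Finset.sum_sub_distrib, maxDrift,
    Finset.mul_sum]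
  refine Finset.sum_le_sum fun n _ => ?_
  set t₀ := idleStart P.Ω P.T k with ht₀
  -- Each device's contribution telescopes over the seconds of the idle period; with no idle time
  -- the sum is empty.
  have htel := Finset.sum_range_sub (fun s : ℕ => P.wallLoss n (t₀ + s) w) (P.Ω (k + 1))
  rw [Nat.cast_zero, add_zero] at htel
  rw [roundStart, ← ht₀, ← htel]
  refine (Finset.sum_le_card_nsmul _ _ (⨆ s : Fin (P.Ω (k + 1)), Δ n (t₀ + ((s : ℕ) : ℝ) + 1))
    fun s hs => ?_).trans (by simp)
  have hs' := Finset.mem_range.1 hs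
  have h1 := hΔ k n ⟨s, hs'⟩ (t₀ + (s : ℝ) + 1) rfl w
  have h2 : t₀ + ((s + 1 : ℕ) : ℝ) = t₀ + (s : ℝ) + 1 := by push_cast; ring
  rw [h2]
  rw [add_sub_cancel_right] at h1
  exact h1.trans (le_ciSup (f := fun s : Fin (P.Ω (k + 1)) => Δ n (t₀ + ((s : ℕ) : ℝ) + 1))
    (Set.finite_range _).bddAbove ⟨s, hs'⟩)

end Drift

/-! ### Step size, averaging over the starting model, and summation over rounds. -/

lemma step_size_bound {β ζ₁ Λ η : ℝ} {m : ℕ} (hβ : 0 < β) (hζ₁ : 1 ≤ ζ₁) (hΛ₀ : 0 ≤ Λ)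
    (hΛ₁ : Λ < 1) (hη : 0 < η) (hm : 1 ≤ m)
    (h : 1 < m → η ≤ 1 / (2 * β) * Real.sqrt (Λ /
      (min (ζ₁ * (β ^ 2 + Λ)) (ζ₁ + Λ) * ((m : ℝ) * ((m : ℝ) - 1))))) :
    4 * (ζ₁ * (β ^ 2 * η ^ 2 * ((m : ℝ) * ((m : ℝ) - 1)))) ≤ 1 := by
  rcases hm.eq_or_lt with rfl | h1
  · simp
  have hm1 : (1 : ℝ) < m := by exact_mod_cast h1
  have hmm : 0 < (m : ℝ) * ((m : ℝ) - 1) := by nlinarith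
  set c := min (ζ₁ * (β ^ 2 + Λ)) (ζ₁ + Λ)
  have hc0 : 0 < c := lt_min (by positivity) (by positivity)
  -- This is all that is used of c: the step size gives 4ζ₁β²η²m(m - 1) ≤ ζ₁Λ/c ≤ 1. The second
  -- branch uses Λ < 1.
  have hc : ζ₁ * Λ ≤ c := le_min (by nlinarith [sq_nonneg β]) (by nlinarith)
  have hsq : η ^ 2 ≤ (1 / (2 * β)) ^ 2 * (Λ / (c * ((m : ℝ) * ((m : ℝ) - 1)))) := by
    rw [← Real.sq_sqrt (show 0 ≤ Λ / (c * ((m : ℝ) * ((m : ℝ) - 1))) by positivity), ← mul_pow]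
    exact pow_le_pow_left₀ hη.le (h h1) 2
  have h2 : 4 * (ζ₁ * (β ^ 2 * η ^ 2 * ((m : ℝ) * ((m : ℝ) - 1)))) ≤
      4 * (ζ₁ * (β ^ 2 * ((1 / (2 * β)) ^ 2 * (Λ / (c * ((m : ℝ) * ((m : ℝ) - 1))))) *
        ((m : ℝ) * ((m : ℝ) - 1)))) := by gcongr
  have h3 : 4 * (ζ₁ * (β ^ 2 * ((1 / (2 * β)) ^ 2 * (Λ / (c * ((m : ℝ) * ((m : ℝ) - 1))))) *
        ((m : ℝ) * ((m : ℝ) - 1)))) = ζ₁ * Λ / c := by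
    have hm1' : (m : ℝ) - 1 ≠ 0 := by linarith
    field_simp
    norm_num
  rw [h3] at h2
  exact h2.trans ((div_le_one hc0).2 hc)

/-- The contribution of one round to the convergence bound. -/
lemma StratifiedSampling.integral_norm_gradient_sq_le [NeZero N]
    {𝓢 : Type*} [MeasurableSpace 𝓢] {μ : Measure 𝓢} [IsProbabilityMeasure μ]
    {b : 𝓢 → P.Batches} (hb : P.StratifiedSampling μ b)
    (hdiff : ∀ k n, ∀ d ∈ P.Dhat k n, Differentiable ℝ (fun w => P.f w d))
    {β : ℝ} (hβ : 0 < β) (hsmooth : P.Smooth β)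
    {ζ₁ ζ₂ : ℝ} (hζ₁ : 1 ≤ ζ₁) (hζ₂ : 0 ≤ ζ₂) (hdis : P.BoundedDissimilarity ζ₁ ζ₂)
    {Θ : Fin N → ℝ} (hΘ₀ : ∀ n, 0 ≤ Θ n) (hΘ : P.DataVariability Θ) {θ : ℝ} (hθ : ∀ n, Θ n ≤ θ)
    {Δ : Fin N → ℝ → ℝ} (hΔ : P.Drift Δ) {Λ : ℝ} (hΛ₀ : 0 ≤ Λ) (hΛ₁ : Λ < 1)
    {k : ℕ} (hη₁ : 4 * (ζ₁ * (β ^ 2 * P.η k ^ 2 * ((P.eMax k : ℝ) * ((P.eMax k : ℝ) - 1)))) ≤ 1)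
    (hη₂ : β * (P.η k * P.eAvg k) ≤ 1 / 2) :
    ∫ s, ‖gradient (P.F k) (P.model (b s) k)‖ ^ 2 ∂μ ≤
      (∫ s, (P.prevF k (P.model (b s) k) - P.F k (P.model (b s) (k + 1))) ∂μ)
          / (P.Gam k * (1 - Λ))
        + (P.Ω (k + 1) : ℝ) * P.maxDrift Δ k / (P.Gam k * (1 - Λ))
        + 1 / (1 - Λ) * P.roundError β ζ₂ θ k := by
  have hint : ∀ φ : EuclideanSpace ℝ (Fin M) → ℝ, Integrable (fun s => φ (P.model (b s) k)) μ :=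
    fun φ => hb.integrable (Z := fun c => φ (P.model c k))
      fun x y h => congrArg φ (dependsOn_model k h)
  have hint' : Integrable (fun s => P.F k (P.model (b s) (k + 1))) μ :=
    hb.integrable (Z := fun c => P.F k (P.model c (k + 1)))
      fun x y h => congrArg (P.F k) (dependsOn_model (k + 1) h)
  let G : EuclideanSpace ℝ (Fin M) → ℝ := fun w =>
    ∫ s, P.F k (w - P.η k • P.aggGrad (b s) k w) ∂μ
  have hdisj : Disjoint (P.idx k ((Finset.range k).sup P.eMax) fun _ _ _ => True)
      (P.idx (k + 1) (P.eMax k) fun k' _ _ => k' = k) := by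
    refine Finset.disjoint_left.2 fun j hj hj' => ?_
    have h1 := P.mem_idx.1 hj
    have h2 := P.mem_idx.1 hj'
    omega
  -- The model entering round k depends on earlier rounds only, so the deterministic-start estimate
  -- applies with that model frozen.
  have hcond : ∫ s, P.F k (P.model (b s) (k + 1)) ∂μ = ∫ s, G (P.model (b s) k) ∂μ :=
    hb.integral_integral hdisj (Z := fun c => P.model c k)
      (F := fun w c => P.F k (w - P.η k • P.aggGrad c k w)) (dependsOn_model k)
      fun w x y h => by
        have := dependsOn_aggGrad (P := P) k w k.lt_succ_self le_rfl
          (q := fun k' _ _ => k' = k) (fun _ _ => rfl) h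
        simp only at this ⊢
        rw [this]
  have hpt : ∀ s, P.Gam k * ‖gradient (P.F k) (P.model (b s) k)‖ ^ 2 ≤
      P.prevF k (P.model (b s) k) - G (P.model (b s) k)
        + (P.Ω (k + 1) * P.maxDrift Δ k + P.Gam k * P.roundError β ζ₂ θ k) := by
    intro s
    have h1 := hb.gam_mul_norm_gradient_sq_le hdiff hβ hsmooth hζ₁ hζ₂ hdis hΘ₀ hΘ hθ hη₁ hη₂
      (P.model (b s) k)
    have h2 := F_sub_prevF_le hΔ k (P.model (b s) k)
    change _ ≤ _ - G _ + _ at h1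
    linarith
  have hsub : Integrable (fun s => P.prevF k (P.model (b s) k) - G (P.model (b s) k)) μ :=
    (hint (P.prevF k)).sub (hint G)
  have hmono := integral_mono ((hint fun w => ‖gradient (P.F k) w‖ ^ 2).const_mul (P.Gam k))
    (hsub.add (integrable_const _)) hpt
  have hrhs : ∫ s, (P.prevF k (P.model (b s) k) - G (P.model (b s) k)
        + (P.Ω (k + 1) * P.maxDrift Δ k + P.Gam k * P.roundError β ζ₂ θ k)) ∂μ =
      ∫ s, (P.prevF k (P.model (b s) k) - P.F k (P.model (b s) (k + 1))) ∂μ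
        + (P.Ω (k + 1) * P.maxDrift Δ k + P.Gam k * P.roundError β ζ₂ θ k) := by
    rw [integral_add hsub (integrable_const _),
      integral_sub (hint (P.prevF k)) (hint G), integral_sub (hint (P.prevF k)) hint', hcond]
    simp
  have hmain := hmono.trans_eq hrhs
  rw [integral_const_mul] at hmain
  set Q := ∫ s, ‖gradient (P.F k) (P.model (b s) k)‖ ^ 2 ∂μ with hQ
  have hQ0 : 0 ≤ Q := integral_nonneg fun _ => sq_nonneg _
  have hΓ := P.Gam_pos k
  have hΛ : 0 < 1 - Λ := by linarith
  have hle : Q * (P.Gam k * (1 - Λ)) ≤ P.Gam k * Q := by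
    have := mul_nonneg (mul_nonneg hΓ.le hQ0) hΛ₀
    linarith
  have hfin : 1 / (1 - Λ) * P.roundError β ζ₂ θ k =
      P.Gam k * P.roundError β ζ₂ θ k / (P.Gam k * (1 - Λ)) := by
    field_simp
  rw [hfin, ← add_div, ← add_div, le_div_iff₀ (mul_pos hΓ hΛ)]
  linarith

end PSL

theorem theorem1 {N M p : ℕ} {X : Type*} [DecidableEq X] (P : PSL N M p X)
    {𝓢 : Type*} [MeasurableSpace 𝓢] (μ : Measure 𝓢) [IsProbabilityMeasure μ]
    (b : 𝓢 → P.Batches) (hb : P.StratifiedSampling μ b)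
    (hdiff : ∀ k n, ∀ d ∈ P.Dhat k n, Differentiable ℝ (fun w => P.f w d))
    (β : ℝ) (hβ : 0 < β) (hsmooth : P.Smooth β)
    (ζ₁ ζ₂ : ℝ) (hζ₁ : 1 ≤ ζ₁) (hζ₂ : 0 ≤ ζ₂) (hdis : P.BoundedDissimilarity ζ₁ ζ₂)
    (Θ : Fin N → ℝ) (hΘ₀ : ∀ n, 0 ≤ Θ n) (hΘ : P.DataVariability Θ)
    (Δ : Fin N → ℝ → ℝ) (hΔ : P.Drift Δ)
    (K : ℕ) (hK : 1 ≤ K)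
    (Λ : ℕ → ℝ) (hΛ₀ : ∀ k < K, 0 ≤ Λ k) (hΛ₁ : ∀ k < K, Λ k < 1)
    -- if all devices make one iteration, the first bound on the step size is infinite
    (hη₁ : ∀ k < K, 1 < P.eMax k →
      P.η k ≤ 1 / (2 * β) * Real.sqrt (Λ k /
        (min (ζ₁ * (β ^ 2 + Λ k)) (ζ₁ + Λ k) * ((P.eMax k : ℝ) * ((P.eMax k : ℝ) - 1)))))
    (hη₂ : ∀ k < K, P.η k ≤ (2 * β * P.eAvg k)⁻¹) :
    (1 / (K : ℝ)) * ∑ k ∈ Finset.range K,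
        ∫ s, ‖gradient (P.F k) (P.model (b s) k)‖ ^ 2 ∂μ ≤
      (1 / (K : ℝ)) *
        (∑ k ∈ Finset.range K,
            (∫ s, (P.prevF k (P.model (b s) k) - P.F k (P.model (b s) (k + 1))) ∂μ) /
              (P.Gam k * (1 - Λ k))
          + ∑ k ∈ Finset.range K,
            (P.Ω (k + 1) : ℝ) * P.maxDrift Δ k / (P.Gam k * (1 - Λ k))
          + ∑ k ∈ Finset.range K, 1 / (1 - Λ k) *
            (8 * β ^ 2 * (⨆ n, Θ n) ^ 2 * P.η k ^ 2 *
                ∑ n, P.Dn k n / P.D k * ((P.e k n : ℝ) - 1) * P.noise k n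
              + 8 * ζ₂ * P.η k ^ 2 * β ^ 2 * (P.eMax k : ℝ) * ((P.eMax k : ℝ) - 1)
              + 8 * (⨆ n, Θ n) ^ 2 * β * P.Gam k *
                ∑ n, (P.Dn k n / (P.D k * Real.sqrt (P.e k n : ℝ))) ^ 2 * P.noise k n)) := by
  rcases Nat.eq_zero_or_pos N with rfl | hN
  -- Without devices the loss is zero, Γ = 0 turns the quotients into 0, and the maximal iteration
  -- count is 0.
  · have hF : ∀ k, P.F k = fun _ => 0 := fun k => by
      funext w
      simp [PSL.F, globalLoss]
    simp [hF, PSL.Gam, PSL.eAvg, PSL.eMax]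
  have : NeZero N := ⟨hN.ne'⟩
  have hθ : ∀ n, Θ n ≤ ⨆ n, Θ n := le_ciSup (Set.finite_range Θ).bddAbove
  rw [← Finset.sum_add_distrib, ← Finset.sum_add_distrib]
  refine mul_le_mul_of_nonneg_left (Finset.sum_le_sum fun k hk => ?_) (by positivity)
  have hkK := Finset.mem_range.1 hk
  have hm : 1 ≤ P.eMax k := (P.e_pos k 0).trans (P.e_le_eMax k 0)
  refine hb.integral_norm_gradient_sq_le hdiff hβ hsmooth hζ₁ hζ₂ hdis hΘ₀ hΘ hθ hΔ (hΛ₀ k hkK)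
    (hΛ₁ k hkK)
    (PSL.step_size_bound hβ hζ₁ (hΛ₀ k hkK) (hΛ₁ k hkK) (P.η_pos k) hm (hη₁ k hkK)) ?_
  have he := P.eAvg_pos k
  have h := mul_le_mul_of_nonneg_right (hη₂ k hkK) (mul_pos hβ he).le
  have h1 : (2 * β * P.eAvg k)⁻¹ * (β * P.eAvg k) = 1 / 2 := by field_simp
  rw [h1] at h
  linarith
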